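/- For each $n\ge 1$ let $p=p_n\in[0,1]$, let $\eta_1,\dots,\eta_{n+1}$ be independent Bernoulli random variables with $P(\eta_j=1)=p=1-P(\eta_j=0)$, and let $$\tilde S=\sum_{j=1}^{n}\eta_j(1-\eta_{j+1}),\qquad \alpha=p(1-p),\qquad N=\left\lfloor \frac{n^2}{3n-2}\right\rfloor,\qquad \tilde p=\frac{n\alpha}{N}.$$ Write $$\mathrm{Bi}(N,\tilde p)\{k\}=\binom{N}{k}\tilde p^{\,k}(1-\tilde p)^{N-k},\qquad k=0,1,2,\dots,$$ with the value $0$ for $k>N$. Let $x=x_n$ be non-negative integers, and assume that, as $n\to\infty$, $p\to0$, $np\to\infty$ and $$|x-n\alpha|=o\bigl(\min(np,\,n^{2/3})\bigr).$$ Then, as $n\to\infty$, $$\frac{P(\tilde S=x)}{\mathrm{Bi}(N,\tilde p)\{x\}}\longrightarrow 1 .$$ -/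

import Mathlib

open MeasureTheory ProbabilityTheory Filter Topology Asymptotics

/-- The statistic `∑_{j=1}^n η_j (1 - η_{j+1})` of `n + 1` random variables
`η_1, …, η_{n+1}` (here indexed from `0` to `n`). -/
def countN11 {Ω : Type*} {n : ℕ} (η : Fin (n + 1) → Ω → ℝ) (ω : Ω) : ℝ :=
  ∑ j : Fin n, η j.castSucc ω * (1 - η j.succ ω)

/-- `α(p) = p (1 - p)`. -/
def alphaN11 (p : ℝ) : ℝ := p * (1 - p)

/-- The number of trials `N = ⌊n² / (3n - 2)⌋` of the approximating binomial law. -/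
noncomputable def binN (n : ℕ) : ℕ := ⌊(n : ℝ) ^ 2 / (3 * (n : ℝ) - 2)⌋₊

/-- The success probability `n α(p) / N` of the approximating binomial law. -/
noncomputable def binP (n : ℕ) (p : ℝ) : ℝ := (n : ℝ) * alphaN11 p / (binN n : ℝ)

/-- The binomial weight `Bi(N, q){k} = C(N, k) q^k (1 - q)^(N - k)` (it is `0` for `k > N`). -/
noncomputable def binomialWeight (N : ℕ) (q : ℝ) (k : ℕ) : ℝ :=
  (N.choose k : ℝ) * q ^ k * (1 - q) ^ (N - k)

/-!
The probability generating function of the descent count `S̃` is `F (α (z - 1))`, where `F` is the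
polynomial with coefficients `(n + 1 - k).choose k`. It is a rescaled Chebyshev polynomial of the
second kind, so its zeros are real and negative and `S̃` is distributed as a sum of independent
Bernoulli variables, with success probabilities `aᵢ = α (2 cos (π i / (n + 2)))²`. These satisfy
`∑ aᵢ = n α` and `∑ aᵢ² = α² (3 n - 2)`; the binomial law has the same mean, and `N` is chosen to
make its sum of squares `N p̃²` agree with `∑ aᵢ²` up to `O(α²)`.

Tilt both laws exponentially, so that the mean of the tilted binomial law is `x`. By a local limit
theorem at the mean the tilted point probabilities are asymptotically equal. The two normalising
products `∏ (1 + aᵢ s)` are asymptotically equal as well: their logarithms agree to second order in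
`s`, and the cubic remainder is of order `|x - n α|³ / n²`, which is why `n ^ (2 / 3)` appears.
-/

section Fibonacci

open Polynomial

variable (R : Type*) [CommRing R]

/-- The Fibonacci-type polynomials `F₀ = F₁ = 1`, `F_{n+2} = F_{n+1} + X F_n`; the generating
polynomial of the number of descents of a random binary word is one of them. -/
noncomputable def fibPoly : ℕ → R[X]
  | 0 => 1
  | 1 => 1
  | n + 2 => fibPoly (n + 1) + X * fibPoly n

lemma coeff_fibPoly (n k : ℕ) : (fibPoly R n).coeff k = (n - k).choose k := by
  induction n using fibPoly.induct generalizing k with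
  | case1 => cases k <;> simp [fibPoly, coeff_one]
  | case2 => rcases k with _ | _ | k <;> simp [fibPoly, coeff_one]
  | case3 n ih₁ ih₀ =>
    cases k with
    | zero => simp [fibPoly, ih₁]
    | succ k =>
      rw [fibPoly, coeff_add, coeff_X_mul, ih₁, ih₀, Nat.add_sub_add_right, Nat.succ_eq_add_one,
        show n + 2 - (k + 1) = n + 1 - k by omega]
      obtain h | h := le_or_gt k n
      · rw [Nat.succ_sub h, Nat.choose_succ_succ, Nat.cast_add, add_comm]
      · simp [Nat.sub_eq_zero_of_le h.le, Nat.sub_eq_zero_of_le h, Nat.choose_eq_zero_of_lt,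
          Nat.zero_lt_of_lt h]

lemma natDegree_fibPoly_le (n : ℕ) : (fibPoly R n).natDegree ≤ n / 2 := by
  refine natDegree_le_iff_coeff_eq_zero.2 fun k hk => ?_
  rw [coeff_fibPoly, Nat.choose_eq_zero_of_lt (by omega), Nat.cast_zero]

lemma eval_fibPoly_neg_inv_sq_mul_pow {F : Type*} [Field F] (n : ℕ) {y : F} (hy : 2 * y ≠ 0) :
    (fibPoly F n).eval (-((2 * y) ^ 2)⁻¹) * (2 * y) ^ n = (Chebyshev.U F n).eval y := by
  induction n using fibPoly.induct with
  | case1 => simp [fibPoly]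
  | case2 => simp [fibPoly]
  | case3 n ih₁ ih₀ =>
    have hU : (Chebyshev.U F ((n + 2 : ℕ) : ℤ)).eval y =
        2 * y * (Chebyshev.U F ((n + 1 : ℕ) : ℤ)).eval y - (Chebyshev.U F (n : ℤ)).eval y := by
      push_cast
      simp [Chebyshev.U_add_two]
    have hinv : ((2 * y) ^ 2)⁻¹ * (2 * y) ^ 2 = 1 := inv_mul_cancel₀ (pow_ne_zero 2 hy)
    rw [hU, ← ih₁, ← ih₀, fibPoly, eval_add, eval_mul, eval_X, Nat.succ_eq_add_one]
    linear_combination (-(eval (-((2 * y) ^ 2)⁻¹) (fibPoly F n)) * (2 * y) ^ n) * hinv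

/-- The numbers `4 cos² (π (i + 1) / (n + 1))`, `i < n / 2`; the zeros of `fibPoly ℝ n` are their
negated inverses. -/
noncomputable def fibRoot (n : ℕ) (i : Fin (n / 2)) : ℝ :=
  (2 * Real.cos ((i + 1) * Real.pi / (n + 1))) ^ 2

lemma fibRoot_angle_mem_Ioo (n : ℕ) (i : Fin (n / 2)) :
    (i + 1) * Real.pi / (n + 1) ∈ Set.Ioo 0 (Real.pi / 2) := by
  have hi : ((i : ℕ) + 1) * 2 < n + 1 := by omega
  have hi' : ((i : ℝ) + 1) * 2 < n + 1 := by exact_mod_cast hi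
  have hπ := Real.pi_pos
  refine ⟨by positivity, ?_⟩
  rw [div_lt_div_iff₀ (by positivity) (by norm_num)]
  nlinarith

lemma cos_fibRoot_angle_pos (n : ℕ) (i : Fin (n / 2)) :
    0 < Real.cos ((i + 1) * Real.pi / (n + 1)) :=
  have h := fibRoot_angle_mem_Ioo n i
  Real.cos_pos_of_mem_Ioo ⟨by linarith [h.1, Real.pi_pos], h.2⟩

lemma fibRoot_pos (n : ℕ) (i : Fin (n / 2)) : 0 < fibRoot n i :=
  pow_pos (mul_pos two_pos (cos_fibRoot_angle_pos n i)) 2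

lemma fibRoot_le_four (n : ℕ) (i : Fin (n / 2)) : fibRoot n i ≤ 4 := by
  rw [fibRoot, mul_pow]
  linarith [Real.cos_sq_le_one ((i + 1) * Real.pi / (n + 1))]

lemma fibRoot_injective (n : ℕ) : Function.Injective (fibRoot n) := by
  intro i j h
  have hcos : Real.cos ((i + 1) * Real.pi / (n + 1)) = Real.cos ((j + 1) * Real.pi / (n + 1)) :=
    mul_left_cancel₀ two_ne_zero <| (pow_left_inj₀
      (mul_pos two_pos (cos_fibRoot_angle_pos n i)).le
      (mul_pos two_pos (cos_fibRoot_angle_pos n j)).le two_ne_zero).1 h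
  have mem_Icc (k : Fin (n / 2)) : (k + 1) * Real.pi / (n + 1) ∈ Set.Icc 0 Real.pi :=
    have hk := fibRoot_angle_mem_Ioo n k
    ⟨hk.1.le, by linarith [hk.2, Real.pi_pos]⟩
  have hangle := Real.injOn_cos (mem_Icc i) (mem_Icc j) hcos
  field_simp at hangle
  exact Fin.ext (by exact_mod_cast add_right_cancel hangle)

lemma eval_fibPoly_neg_inv_fibRoot (n : ℕ) (i : Fin (n / 2)) :
    (fibPoly ℝ n).eval (-(fibRoot n i)⁻¹) = 0 := by
  have hcos := (mul_pos two_pos (cos_fibRoot_angle_pos n i)).ne'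
  have hU : Real.cos ((i + 1) * Real.pi / (n + 1)) ∈ (Chebyshev.U ℝ n).roots := by
    rw [Chebyshev.roots_U_real]
    exact Finset.mem_image_of_mem (fun k : ℕ => Real.cos ((k + 1) * Real.pi / (n + 1)))
      (Finset.mem_range.2 (by omega : (i : ℕ) < n))
  have h := eval_fibPoly_neg_inv_sq_mul_pow n hcos
  rw [isRoot_of_mem_roots hU] at h
  exact (mul_eq_zero.1 h).resolve_right (pow_ne_zero n hcos)

lemma fibPoly_eq_prod (n : ℕ) : fibPoly ℝ n = ∏ i, (1 + C (fibRoot n i) * X) := by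
  classical
  let s : Finset ℝ := insert 0 (Finset.univ.image fun i => -(fibRoot n i)⁻¹)
  have hs : s.card = n / 2 + 1 := by
    rw [Finset.card_insert_of_notMem, Finset.card_image_of_injective, Finset.card_univ,
      Fintype.card_fin]
    · exact neg_injective.comp (inv_injective.comp (fibRoot_injective n))
    · simp [(fibRoot_pos n _).ne']
  refine eq_of_natDegree_lt_card_of_eval_eq' _ _ s ?_ ?_
  · intro x hx
    rcases Finset.mem_insert.1 hx with rfl | hx
    · simp [← coeff_zero_eq_eval_zero, coeff_fibPoly, coeff_zero_prod]
    · obtain ⟨i, -, rfl⟩ := Finset.mem_image.1 hx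
      rw [eval_fibPoly_neg_inv_fibRoot, eval_prod, Finset.prod_eq_zero (Finset.mem_univ i)]
      simp [(fibRoot_pos n i).ne']
  · rw [hs, Nat.lt_succ_iff]
    refine max_le (natDegree_fibPoly_le ℝ n) ((natDegree_prod_le _ _).trans ?_)
    refine (Finset.sum_le_card_nsmul _ _ 1 fun i _ => ?_).trans (by simp)
    compute_degree

variable {R}

lemma coeff_one_prod_one_add_C_mul_X {ι : Type*} (s : Finset ι) (c : ι → R) :
    (∏ i ∈ s, (1 + C (c i) * X)).coeff 1 = ∑ i ∈ s, c i := by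
  classical
  induction s using Finset.induction_on with
  | empty => simp [coeff_one]
  | insert a s ha ih =>
    simp [Finset.prod_insert ha, Finset.sum_insert ha, add_mul, mul_assoc, ih, coeff_zero_prod,
      coeff_X_mul, add_comm]

lemma two_mul_coeff_two_prod_one_add_C_mul_X {ι : Type*} (s : Finset ι) (c : ι → R) :
    2 * (∏ i ∈ s, (1 + C (c i) * X)).coeff 2 = (∑ i ∈ s, c i) ^ 2 - ∑ i ∈ s, c i ^ 2 := by
  classical
  induction s using Finset.induction_on with
  | empty => simp [coeff_one]
  | insert a s ha ih =>
    rw [Finset.prod_insert ha, Finset.sum_insert ha, Finset.sum_insert ha, add_mul, one_mul,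
      mul_assoc, coeff_add, coeff_C_mul, coeff_X_mul, coeff_one_prod_one_add_C_mul_X]
    linear_combination ih

lemma sum_fibRoot (n : ℕ) : ∑ i, fibRoot (n + 1) i = n := by
  rw [← coeff_one_prod_one_add_C_mul_X, ← fibPoly_eq_prod, coeff_fibPoly, Nat.choose_one_right,
    Nat.add_sub_cancel]

lemma sum_fibRoot_sq {n : ℕ} (hn : 1 ≤ n) : ∑ i, fibRoot (n + 1) i ^ 2 = 3 * n - 2 := by
  obtain ⟨m, rfl⟩ := Nat.exists_eq_add_of_le' hn
  have h := two_mul_coeff_two_prod_one_add_C_mul_X Finset.univ (fibRoot (m + 1 + 1))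
  rw [← fibPoly_eq_prod, coeff_fibPoly, sum_fibRoot, Nat.add_sub_cancel (m := 2),
    Nat.cast_choose_two] at h
  push_cast at h ⊢
  linear_combination h

end Fibonacci

section Descents

open Polynomial

variable {R : Type*} [CommRing R]

/-- The probability of the binary word `b`, its letters being independent Bernoulli with parameter
`p`. -/
def wordWeight (p : R) {n : ℕ} (b : Fin n → Bool) : R :=
  ∏ i, if b i then p else 1 - p

/-- The number of descents `10` in a binary word. -/
def descents {n : ℕ} (b : Fin (n + 1) → Bool) : ℕ :=
  ∑ j : Fin n, if b j.castSucc ∧ ¬ b j.succ then 1 else 0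

/-- The generating polynomial of the number of descents of a random binary word of length `n + 1`,
restricted to the words that start with the letter `c`. -/
noncomputable def descentPoly (p : R) (n : ℕ) (c : Bool) : R[X] :=
  ∑ b : Fin n → Bool, C (wordWeight p (Fin.cons c b : Fin (n + 1) → Bool)) *
    X ^ descents (Fin.cons c b : Fin (n + 1) → Bool)

lemma wordWeight_cons (p : R) {n : ℕ} (c : Bool) (b : Fin n → Bool) :
    wordWeight p (Fin.cons c b : Fin (n + 1) → Bool) =
      (if c then p else 1 - p) * wordWeight p b := by
  simp [wordWeight, Fin.prod_univ_succ]

lemma descents_cons {n : ℕ} (c d : Bool) (b : Fin n → Bool) :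
    descents (Fin.cons c (Fin.cons d b : Fin (n + 1) → Bool) : Fin (n + 2) → Bool) =
      (if c ∧ ¬ d then 1 else 0) + descents (Fin.cons d b : Fin (n + 1) → Bool) := by
  rw [descents, Fin.sum_univ_succ]
  simp [descents]

lemma sum_fin_succ_fun {α M : Type*} [Fintype α] [AddCommMonoid M] {n : ℕ}
    (f : (Fin (n + 1) → α) → M) :
    ∑ b, f b = ∑ c : α, ∑ b : Fin n → α, f (Fin.cons c b) := by
  rw [← Fintype.sum_prod_type' (f := fun c b => f (Fin.cons c b))]
  exact (Equiv.sum_comp (Fin.consEquiv fun _ => α) f).symm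

lemma descentPoly_succ (p : R) (n : ℕ) (c : Bool) :
    descentPoly p (n + 1) c = C (if c then p else 1 - p) *
      ∑ d : Bool, X ^ (if c ∧ ¬ d then 1 else 0) * descentPoly p n d := by
  rw [descentPoly, sum_fin_succ_fun, Finset.mul_sum]
  refine Finset.sum_congr rfl fun d _ => ?_
  rw [descentPoly, Finset.mul_sum, Finset.mul_sum]
  refine Finset.sum_congr rfl fun b _ => ?_
  rw [wordWeight_cons, descents_cons, pow_add, C_mul]
  ring

lemma descentPoly_eq_fibPoly (p : R) (n : ℕ) :
    descentPoly p n false = C (1 - p) * (fibPoly R n).comp (C (p * (1 - p)) * (X - 1)) ∧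
    descentPoly p n true + descentPoly p n false =
      (fibPoly R (n + 1)).comp (C (p * (1 - p)) * (X - 1)) := by
  induction n with
  | zero => simp [descentPoly, fibPoly, wordWeight, descents]
  | succ n ih =>
    obtain ⟨ih_false, ih_sum⟩ := ih
    have h_false : descentPoly p (n + 1) false =
        C (1 - p) * (descentPoly p n true + descentPoly p n false) := by
      simp [descentPoly_succ]
    have h_true : descentPoly p (n + 1) true =
        C p * (descentPoly p n true + X * descentPoly p n false) := by
      simp [descentPoly_succ]
    refine ⟨by rw [h_false, ih_sum], ?_⟩
    rw [h_false, h_true, fibPoly, add_comp, mul_comp, X_comp, ← ih_sum]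
    simp only [C_mul, C_sub, C_1] at ih_false ⊢
    linear_combination C p * (X - 1) * ih_false

lemma sum_wordWeight_mul_X_pow_descents (p : R) (n : ℕ) :
    ∑ b : Fin (n + 1) → Bool, C (wordWeight p b) * X ^ descents b =
      (fibPoly R (n + 1)).comp (C (p * (1 - p)) * (X - 1)) := by
  rw [← (descentPoly_eq_fibPoly p n).2, sum_fin_succ_fun, Fintype.sum_bool]
  rfl

lemma sum_wordWeight_filter_descents_eq (p : R) (n k : ℕ) :
    ∑ b : Fin (n + 1) → Bool with descents b = k, wordWeight p b =
      ((fibPoly R (n + 1)).comp (C (p * (1 - p)) * (X - 1))).coeff k := by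
  simp only [← sum_wordWeight_mul_X_pow_descents, finsetSum_coeff, coeff_C_mul_X_pow,
    Finset.sum_filter, eq_comm]

end Descents

section CountLaw

open Polynomial

variable {Ω : Type*} {n : ℕ}

/-- The event that the sequence `η` of random variables spells the binary word `b`. -/
def wordEvent (η : Fin n → Ω → ℝ) (b : Fin n → Bool) : Set Ω :=
  ⋂ j, η j ⁻¹' {if b j then 1 else 0}

lemma mem_wordEvent {η : Fin n → Ω → ℝ} {b : Fin n → Bool} {ω : Ω} :
    ω ∈ wordEvent η b ↔ ∀ j, η j ω = if b j then 1 else 0 := by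
  simp [wordEvent]

lemma disjoint_wordEvent (η : Fin n → Ω → ℝ) {b b' : Fin n → Bool} (hb : b ≠ b') :
    Disjoint (wordEvent η b) (wordEvent η b') := by
  refine Set.disjoint_left.2 fun ω h h' => hb (funext fun j => ?_)
  have hj := (mem_wordEvent.1 h j).symm.trans (mem_wordEvent.1 h' j)
  cases hbj : b j <;> cases hbj' : b' j <;> simp_all

lemma countN11_of_mem_wordEvent {η : Fin (n + 1) → Ω → ℝ} {b : Fin (n + 1) → Bool} {ω : Ω}
    (h : ω ∈ wordEvent η b) : countN11 η ω = descents b := by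
  simp only [countN11, descents, mem_wordEvent.1 h, Nat.cast_sum]
  refine Finset.sum_congr rfl fun j _ => ?_
  cases b j.castSucc <;> cases b j.succ <;> simp

variable [MeasurableSpace Ω] {μ : Measure Ω} {p : unitInterval}

lemma ae_eq_zero_or_eq_one {X : Ω → ℝ} (hX : HasLaw X (bernoulliMeasure (1 : ℝ) 0 p) μ) :
    ∀ᵐ ω ∂μ, X ω = 0 ∨ X ω = 1 := by
  have hm : MeasurableSet {y : ℝ | ¬ (y = 0 ∨ y = 1)} := by measurability
  rw [ae_iff, hX.measure_eq hm, bernoulliMeasure_apply_of_notMem_of_notMem p hm (by simp) (by simp)]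

lemma ae_exists_mem_wordEvent {η : Fin n → Ω → ℝ}
    (hη : ∀ j, HasLaw (η j) (bernoulliMeasure (1 : ℝ) 0 p) μ) :
    ∀ᵐ ω ∂μ, ∃ b, ω ∈ wordEvent η b := by
  filter_upwards [ae_all_iff.2 fun j => ae_eq_zero_or_eq_one (hη j)] with ω hω
  refine ⟨fun j => decide (η j ω = 1), mem_wordEvent.2 fun j => ?_⟩
  rcases hω j with h | h <;> simp [h]

lemma nullMeasurableSet_wordEvent {η : Fin n → Ω → ℝ} (hη : ∀ j, AEMeasurable (η j) μ)
    (b : Fin n → Bool) : NullMeasurableSet (wordEvent η b) μ :=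
  .iInter fun j => (hη j).nullMeasurableSet_preimage (measurableSet_singleton _)

lemma measureReal_wordEvent {η : Fin n → Ω → ℝ}
    (hη : ∀ j, HasLaw (η j) (bernoulliMeasure (1 : ℝ) 0 p) μ) (hindep : iIndepFun η μ)
    (b : Fin n → Bool) : μ.real (wordEvent η b) = wordWeight (p : ℝ) b := by
  have h := hindep.measure_inter_preimage_eq_mul (S := Finset.univ)
    (sets := fun j => {if b j then (1 : ℝ) else 0}) fun j _ => measurableSet_singleton _
  simp only [Finset.mem_univ, Set.iInter_true] at h
  rw [wordEvent, measureReal_def, h, ENNReal.toReal_prod, wordWeight]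
  refine Finset.prod_congr rfl fun j _ => ?_
  rw [← Measure.map_apply_of_aemeasurable (hη j).aemeasurable (measurableSet_singleton _),
    (hη j).map_eq, ← measureReal_def, bernoulliMeasure_real_apply p (measurableSet_singleton _)]
  cases b j <;> simp

lemma setOf_countN11_eq_ae_eq {η : Fin (n + 1) → Ω → ℝ}
    (hη : ∀ j, HasLaw (η j) (bernoulliMeasure (1 : ℝ) 0 p) μ) (k : ℕ) :
    {ω | countN11 η ω = k} =ᵐ[μ]
      ⋃ b ∈ ({b | descents b = k} : Finset (Fin (n + 1) → Bool)), wordEvent η b := by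
  filter_upwards [ae_exists_mem_wordEvent hη] with ω ⟨b, hb⟩
  refine propext (?_ : ω ∈ {ω | countN11 η ω = k} ↔ ω ∈ ⋃ b ∈ _, _)
  simp only [Set.mem_ofPred_eq, Set.mem_iUnion, Finset.mem_filter, Finset.mem_univ, true_and,
    exists_prop]
  constructor
  · intro h
    rw [countN11_of_mem_wordEvent hb] at h
    exact ⟨b, Nat.cast_injective h, hb⟩
  · rintro ⟨b', rfl, hb'⟩
    exact countN11_of_mem_wordEvent hb'

lemma measureReal_countN11_eq {η : Fin (n + 1) → Ω → ℝ}
    (hη : ∀ j, HasLaw (η j) (bernoulliMeasure (1 : ℝ) 0 p) μ) (hindep : iIndepFun η μ) (k : ℕ) :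
    μ.real {ω | countN11 η ω = k} =
      ((fibPoly ℝ (n + 1)).comp (C (alphaN11 p) * (X - 1))).coeff k := by
  have : IsProbabilityMeasure μ := hindep.isProbabilityMeasure
  rw [measureReal_congr (setOf_countN11_eq_ae_eq hη k), measureReal_biUnion_finset₀
    (fun b _ b' _ hb => (disjoint_wordEvent η hb).aedisjoint)
    (fun b _ => nullMeasurableSet_wordEvent (fun j => (hη j).aemeasurable) b),
    alphaN11, ← sum_wordWeight_filter_descents_eq]
  exact Finset.sum_congr rfl fun b _ => measureReal_wordEvent hη hindep b

end CountLaw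

section PoissonBinomial

open Polynomial

variable {ι : Type*} [Fintype ι]

/-- The probability generating polynomial of a sum of independent Bernoulli variables with
success probabilities `a i`; its coefficients are the weights of the Poisson binomial law. -/
noncomputable def poissonBinomialPoly {R : Type*} [CommRing R] (a : ι → R) : R[X] :=
  ∏ i, (1 + C (a i) * (X - 1))

lemma poissonBinomialPoly_mul_fibRoot (n : ℕ) (α : ℝ) :
    poissonBinomialPoly (fun i => α * fibRoot n i) = (fibPoly ℝ n).comp (C α * (X - 1)) := by
  simp only [poissonBinomialPoly, fibPoly_eq_prod, prod_comp, add_comp, one_comp, mul_comp, C_comp,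
    X_comp, C_mul]
  exact Finset.prod_congr rfl fun i _ => by ring

lemma binomialWeight_eq_coeff (N : ℕ) (q : ℝ) (k : ℕ) :
    binomialWeight N q k = (poissonBinomialPoly fun _ : Fin N => q).coeff k := by
  have h : (1 + C q * (X - 1) : ℝ[X]) = C q * X + C (1 - q) := by rw [C_sub, C_1]; ring
  rw [poissonBinomialPoly, Finset.prod_const, Finset.card_univ, Fintype.card_fin, h, add_pow,
    finsetSum_coeff, binomialWeight]
  simp_rw [mul_pow, ← C_pow, ← C_eq_natCast, mul_right_comm _ (X ^ _), ← C_mul, coeff_C_mul_X_pow]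
  rw [Finset.sum_ite_eq]
  split_ifs with hk
  · ring
  · rw [Nat.choose_eq_zero_of_lt (by simpa using hk)]
    simp

end PoissonBinomial

section CharacteristicFunction

open Polynomial

lemma toAddCircle_coe_apply (Q : ℂ[X]) (θ : ℝ) :
    Q.toAddCircle (θ : AddCircle (2 * Real.pi)) = Q.eval (Complex.exp (θ * Complex.I)) := by
  induction Q using Polynomial.induction_on' with
  | add p q hp hq => rw [map_add, ContinuousMap.add_apply, hp, hq, eval_add]
  | monomial m c =>
    have hπ : (Real.pi : ℂ) ≠ 0 := by simp [Real.pi_ne_zero]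
    rw [toAddCircle_monomial_eq_smul_fourier, ContinuousMap.smul_apply, fourier_coe_apply,
      eval_monomial, ← Complex.exp_nat_mul, smul_eq_mul]
    congr 2
    push_cast
    field_simp

lemma integral_aeval_exp_mul_exp (Q : ℝ[X]) (k : ℕ) :
    ∫ θ in (-Real.pi)..Real.pi,
      aeval (Complex.exp (θ * Complex.I)) Q * Complex.exp (-(k * θ * Complex.I)) =
      2 * Real.pi * Q.coeff k := by
  have : Fact (0 < 2 * Real.pi) := ⟨Real.two_pi_pos⟩
  have hπ : (Real.pi : ℂ) ≠ 0 := by simp [Real.pi_ne_zero]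
  have hintegrand (θ : ℝ) :
      aeval (Complex.exp (θ * Complex.I)) Q * Complex.exp (-(k * θ * Complex.I)) =
        fourier (-(k : ℤ)) (θ : AddCircle (2 * Real.pi)) •
          (Q.map (algebraMap ℝ ℂ)).toAddCircle θ := by
    rw [toAddCircle_coe_apply, fourier_coe_apply, eval_map_algebraMap, smul_eq_mul, mul_comm]
    congr 2
    push_cast
    field_simp
  have hcoeff := fourierCoeff_toAddCircle_natCast (Q.map (algebraMap ℝ ℂ)) k
  rw [fourierCoeff_eq_intervalIntegral _ _ (-Real.pi), coeff_map,
    show -Real.pi + 2 * Real.pi = Real.pi by ring, ← intervalIntegral.integral_congr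
      fun θ _ => hintegrand θ, Complex.real_smul, Complex.coe_algebraMap] at hcoeff
  rw [← hcoeff, ← mul_assoc, ← Complex.ofReal_ofNat 2, ← Complex.ofReal_mul, ← Complex.ofReal_mul,
    mul_one_div_cancel Real.two_pi_pos.ne', Complex.ofReal_one, one_mul]

lemma norm_one_add_mul_exp_mul_I_sub_one_le {a θ : ℝ} (ha₀ : 0 ≤ a) (ha : a ≤ 1 / 2)
    (hθ : |θ| ≤ Real.pi) :
    ‖1 + (a : ℂ) * (Complex.exp (θ * Complex.I) - 1)‖ ≤ Real.exp (-(a * θ ^ 2 / Real.pi ^ 2)) := by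
  have hnorm : ‖1 + (a : ℂ) * (Complex.exp (θ * Complex.I) - 1)‖ ^ 2 =
      1 - 2 * a * (1 - a) * (1 - Real.cos θ) := by
    rw [← Complex.normSq_eq_norm_sq, Complex.normSq_apply]
    simp only [Complex.add_re, Complex.one_re, Complex.re_ofReal_mul, Complex.sub_re,
      Complex.exp_ofReal_mul_I_re, Complex.add_im, Complex.one_im, Complex.im_ofReal_mul,
      Complex.sub_im, Complex.exp_ofReal_mul_I_im]
    linear_combination a ^ 2 * Real.sin_sq_add_cos_sq θ
  have hcos : 2 / Real.pi ^ 2 * θ ^ 2 ≤ 1 - Real.cos θ := by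
    linarith [Real.cos_le_one_sub_mul_cos_sq hθ]
  have hquad : 2 * (a * θ ^ 2 / Real.pi ^ 2) ≤ 2 * a * (1 - a) * (1 - Real.cos θ) :=
    calc 2 * (a * θ ^ 2 / Real.pi ^ 2) = a * (2 / Real.pi ^ 2 * θ ^ 2) := by ring
      _ ≤ a * (1 - Real.cos θ) := by gcongr
      _ ≤ (2 * (1 - a)) * (a * (1 - Real.cos θ)) :=
        le_mul_of_one_le_left (mul_nonneg ha₀ (by linarith [Real.cos_le_one θ])) (by linarith)
      _ = 2 * a * (1 - a) * (1 - Real.cos θ) := by ring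
  refine le_of_sq_le_sq ?_ (Real.exp_pos _).le
  rw [hnorm, ← Real.exp_nat_mul]
  have hexp := Real.add_one_le_exp (((2 : ℕ) : ℝ) * -(a * θ ^ 2 / Real.pi ^ 2))
  push_cast at hexp ⊢
  linarith

lemma norm_prod_sub_prod_le_sum {ι R : Type*} [NormedCommRing R] [NormOneClass R]
    (s : Finset ι) {f g : ι → R} (hf : ∀ i ∈ s, ‖f i‖ ≤ 1) (hg : ∀ i ∈ s, ‖g i‖ ≤ 1) :
    ‖∏ i ∈ s, f i - ∏ i ∈ s, g i‖ ≤ ∑ i ∈ s, ‖f i - g i‖ := by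
  classical
  induction s using Finset.induction_on with
  | empty => simp
  | insert a s ha ih =>
    rw [Finset.forall_mem_insert] at hf hg
    have hprod : ‖∏ i ∈ s, f i‖ ≤ 1 :=
      (Finset.norm_prod_le _ _).trans (Finset.prod_le_one (fun _ _ => norm_nonneg _) hf.2)
    rw [Finset.prod_insert ha, Finset.prod_insert ha, Finset.sum_insert ha]
    calc ‖f a * ∏ i ∈ s, f i - g a * ∏ i ∈ s, g i‖
        = ‖(f a - g a) * ∏ i ∈ s, f i + g a * (∏ i ∈ s, f i - ∏ i ∈ s, g i)‖ := by ring_nf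
      _ ≤ ‖f a - g a‖ * ‖∏ i ∈ s, f i‖ + ‖g a‖ * ‖∏ i ∈ s, f i - ∏ i ∈ s, g i‖ :=
        (norm_add_le _ _).trans (add_le_add (norm_mul_le _ _) (norm_mul_le _ _))
      _ ≤ ‖f a - g a‖ * 1 + 1 * ∑ i ∈ s, ‖f i - g i‖ := by
        gcongr
        exacts [hg.1, ih hf.2 hg.2]
      _ = ‖f a - g a‖ + ∑ i ∈ s, ‖f i - g i‖ := by ring

lemma norm_exp_ofReal_mul_I_sub_one_le (θ : ℝ) : ‖Complex.exp (θ * Complex.I) - 1‖ ≤ |θ| := by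
  simpa [mul_comm] using Real.norm_exp_I_mul_ofReal_sub_one_le (x := θ)

lemma norm_one_add_mul_exp_mul_I_sub_one_le_one {a : ℝ} (ha₀ : 0 ≤ a) (ha : a ≤ 1) (θ : ℝ) :
    ‖1 + (a : ℂ) * (Complex.exp (θ * Complex.I) - 1)‖ ≤ 1 :=
  calc ‖1 + (a : ℂ) * (Complex.exp (θ * Complex.I) - 1)‖
      = ‖((1 - a : ℝ) : ℂ) + a * Complex.exp (θ * Complex.I)‖ := by push_cast; ring_nf
    _ ≤ ‖((1 - a : ℝ) : ℂ)‖ + ‖(a : ℂ) * Complex.exp (θ * Complex.I)‖ := norm_add_le _ _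
    _ = 1 := by
      rw [norm_mul, Complex.norm_exp_ofReal_mul_I, Complex.norm_of_nonneg ha₀,
        Complex.norm_of_nonneg (sub_nonneg.2 ha)]
      ring

lemma norm_exp_mul_exp_mul_I_sub_one_le_one {a : ℝ} (ha₀ : 0 ≤ a) (θ : ℝ) :
    ‖Complex.exp (a * (Complex.exp (θ * Complex.I) - 1))‖ ≤ 1 := by
  rw [Complex.norm_exp, Real.exp_le_one_iff, Complex.re_ofReal_mul, Complex.sub_re,
    Complex.exp_ofReal_mul_I_re, Complex.one_re]
  exact mul_nonpos_of_nonneg_of_nonpos ha₀ (sub_nonpos.2 (Real.cos_le_one θ))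

lemma norm_one_add_mul_exp_sub_exp_le {a : ℝ} (ha₀ : 0 ≤ a) (ha : a ≤ 1 / 2) (θ : ℝ) :
    ‖1 + (a : ℂ) * (Complex.exp (θ * Complex.I) - 1) -
      Complex.exp (a * (Complex.exp (θ * Complex.I) - 1))‖ ≤ a ^ 2 * θ ^ 2 := by
  set z := Complex.exp (θ * Complex.I) - 1
  have hz : ‖z‖ ≤ 2 := by
    refine (norm_sub_le _ _).trans ?_
    rw [Complex.norm_exp_ofReal_mul_I, norm_one, one_add_one_eq_two]
  have hnorm : ‖(a : ℂ) * z‖ = a * ‖z‖ := by rw [norm_mul, Complex.norm_of_nonneg ha₀]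
  have haz : ‖(a : ℂ) * z‖ ≤ 1 :=
    calc ‖(a : ℂ) * z‖ = a * ‖z‖ := hnorm
      _ ≤ 1 / 2 * 2 := by gcongr
      _ = 1 := by norm_num
  calc ‖1 + (a : ℂ) * z - Complex.exp (a * z)‖
      = ‖Complex.exp (a * z) - 1 - a * z‖ := by rw [norm_sub_rev, sub_sub]
    _ ≤ ‖(a : ℂ) * z‖ ^ 2 := Complex.norm_exp_sub_one_sub_id_le haz
    _ = a ^ 2 * ‖z‖ ^ 2 := by rw [hnorm, mul_pow]
    _ ≤ a ^ 2 * θ ^ 2 := by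
      rw [← sq_abs θ]
      gcongr
      exact norm_exp_ofReal_mul_I_sub_one_le θ

lemma norm_prod_one_add_mul_sub_exp_sum_mul_le {ι : Type*} [Fintype ι] {a : ι → ℝ} {ε : ℝ}
    (ha : ∀ i, a i ∈ Set.Icc 0 ε) (hε : ε ≤ 1 / 2) (θ : ℝ) :
    ‖∏ i, (1 + (a i : ℂ) * (Complex.exp (θ * Complex.I) - 1)) -
      Complex.exp ((∑ i, a i : ℝ) * (Complex.exp (θ * Complex.I) - 1))‖ ≤
      ε * ((∑ i, a i) * θ ^ 2) := by
  have ha' (i : ι) : a i ≤ 1 / 2 := (ha i).2.trans hε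
  rw [Complex.ofReal_sum, Finset.sum_mul, Complex.exp_sum]
  calc _ ≤ ∑ i, ‖1 + (a i : ℂ) * (Complex.exp (θ * Complex.I) - 1) -
        Complex.exp (a i * (Complex.exp (θ * Complex.I) - 1))‖ :=
      norm_prod_sub_prod_le_sum _
        (fun i _ => norm_one_add_mul_exp_mul_I_sub_one_le_one (ha i).1 (by linarith [ha' i]) θ)
        fun i _ => norm_exp_mul_exp_mul_I_sub_one_le_one (ha i).1 θ
    _ ≤ ∑ i, ε * (a i * θ ^ 2) := Finset.sum_le_sum fun i _ =>
      calc _ ≤ a i ^ 2 * θ ^ 2 := norm_one_add_mul_exp_sub_exp_le (ha i).1 (ha' i) θ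
        _ = a i * (a i * θ ^ 2) := by ring
        _ ≤ ε * (a i * θ ^ 2) :=
          mul_le_mul_of_nonneg_right (ha i).2 (mul_nonneg (ha i).1 (sq_nonneg θ))
    _ = ε * ((∑ i, a i) * θ ^ 2) := by rw [← Finset.mul_sum, ← Finset.sum_mul]

lemma norm_exp_mul_I_sub_quadratic_le {θ : ℝ} (hθ : |θ| ≤ 1) :
    ‖Complex.exp (θ * Complex.I) - (1 + θ * Complex.I - θ ^ 2 / 2)‖ ≤ |θ| ^ 3 := by
  have hnorm : ‖(θ * Complex.I : ℂ)‖ = |θ| := by simp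
  have hsum : ∑ m ∈ Finset.range 3, (θ * Complex.I : ℂ) ^ m / (m.factorial : ℂ) =
      1 + θ * Complex.I - θ ^ 2 / 2 := by
    simp [Finset.sum_range_succ, mul_pow, Nat.factorial]
    ring
  have h := Complex.exp_bound (x := θ * Complex.I) (hnorm.trans_le hθ) (n := 3) (by norm_num)
  rw [hnorm, hsum] at h
  refine h.trans (mul_le_of_le_one_right (by positivity) ?_)
  norm_num [Nat.factorial]

end CharacteristicFunction

section LocalLimit

open Polynomial

/-- The characteristic function, at `u / √m`, of the Poisson binomial law with success
probabilities `a` and mean `m = ∑ i, a i`, times the phase that centres the law at `k`. -/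
noncomputable def scaledCharFun {ι : Type*} [Fintype ι] (a : ι → ℝ) (k : ℕ) (u : ℝ) : ℂ :=
  (∏ i, (1 + (a i : ℂ) * (Complex.exp ((u / √(∑ i, a i) : ℝ) * Complex.I) - 1))) *
    Complex.exp (-(k * (u / √(∑ i, a i) : ℝ) * Complex.I))

lemma continuous_scaledCharFun {ι : Type*} [Fintype ι] (a : ι → ℝ) (k : ℕ) :
    Continuous (scaledCharFun a k) := by
  unfold scaledCharFun
  fun_prop

lemma integral_scaledCharFun {ι : Type*} [Fintype ι] {a : ι → ℝ} (ha : 0 < ∑ i, a i) (k : ℕ) :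
    ∫ u in (-(Real.pi * √(∑ i, a i)))..(Real.pi * √(∑ i, a i)), scaledCharFun a k u =
      ((2 * Real.pi * (√(∑ i, a i) * (poissonBinomialPoly a).coeff k) : ℝ) : ℂ) := by
  have hsqrt : √(∑ i, a i) ≠ 0 := (Real.sqrt_pos.2 ha).ne'
  have hsubst := intervalIntegral.integral_comp_div
    (a := -(Real.pi * √(∑ i, a i))) (b := Real.pi * √(∑ i, a i))
    (fun θ : ℝ => (∏ i, (1 + (a i : ℂ) * (Complex.exp (θ * Complex.I) - 1))) *
      Complex.exp (-(k * θ * Complex.I))) hsqrt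
  have haeval (z : ℂ) : aeval z (poissonBinomialPoly a) = ∏ i, (1 + (a i : ℂ) * (z - 1)) := by
    simp [poissonBinomialPoly, map_prod]
  have hcoeff := integral_aeval_exp_mul_exp (poissonBinomialPoly a) k
  simp_rw [haeval] at hcoeff
  rw [neg_div, mul_div_cancel_right₀ _ hsqrt, hcoeff, Complex.real_smul] at hsubst
  unfold scaledCharFun
  rw [hsubst]
  push_cast
  ring

lemma norm_scaledCharFun_le {ι : Type*} [Fintype ι] {a : ι → ℝ} (ha : 0 < ∑ i, a i) (k : ℕ)
    (ha_half : ∀ i, a i ∈ Set.Icc 0 (1 / 2)) {u : ℝ} (hu : |u| ≤ Real.pi * √(∑ i, a i)) :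
    ‖scaledCharFun a k u‖ ≤ Real.exp (-(1 / Real.pi ^ 2) * u ^ 2) := by
  have hsqrt : 0 < √(∑ i, a i) := Real.sqrt_pos.2 ha
  have hphase : ‖Complex.exp (-(k * (u / √(∑ i, a i) : ℝ) * Complex.I))‖ = 1 := by
    simp [Complex.norm_exp]
  have hθ : |u / √(∑ i, a i)| ≤ Real.pi := by
    rwa [abs_div, abs_of_pos hsqrt, div_le_iff₀ hsqrt]
  rw [scaledCharFun, norm_mul, hphase, mul_one, norm_prod]
  calc _ ≤ ∏ i, Real.exp (-(a i * (u / √(∑ i, a i)) ^ 2 / Real.pi ^ 2)) :=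
      Finset.prod_le_prod (fun _ _ => norm_nonneg _) fun i _ =>
        norm_one_add_mul_exp_mul_I_sub_one_le (ha_half i).1 (ha_half i).2 hθ
    _ = Real.exp (-((∑ i, a i) * (u / √(∑ i, a i)) ^ 2 / Real.pi ^ 2)) := by
      rw [← Real.exp_sum, Finset.sum_neg_distrib, ← Finset.sum_div, ← Finset.sum_mul]
    _ = Real.exp (-(1 / Real.pi ^ 2) * u ^ 2) := by
      rw [div_pow, Real.sq_sqrt ha.le, mul_div_cancel₀ _ ha.ne']
      ring_nf

variable {β : Type*} {l : Filter β} {ι : β → Type*} [∀ n, Fintype (ι n)]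

lemma tendsto_ofReal_mul_exp_sub_quadratic {m θ : β → ℝ} {u : ℝ} (hθ : Tendsto θ l (𝓝 0))
    (hmθ : Tendsto (fun n => m n * θ n ^ 2) l (𝓝 (u ^ 2))) :
    Tendsto (fun n => (m n : ℂ) * (Complex.exp (θ n * Complex.I) -
      (1 + θ n * Complex.I - θ n ^ 2 / 2))) l (𝓝 0) := by
  have hbound : Tendsto (fun n => |m n * θ n ^ 2| * |θ n|) l (𝓝 0) := by
    simpa using hmθ.abs.mul hθ.abs
  refine squeeze_zero_norm' ?_ hbound
  filter_upwards [hθ.abs.eventually_le_const (show |(0 : ℝ)| < 1 by norm_num)] with n hn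
  calc _ = |m n| * ‖Complex.exp (θ n * Complex.I) - (1 + θ n * Complex.I - θ n ^ 2 / 2)‖ := by
        rw [norm_mul, Complex.norm_real, Real.norm_eq_abs]
    _ ≤ |m n| * |θ n| ^ 3 := by
      gcongr
      exact norm_exp_mul_I_sub_quadratic_le hn
    _ = |m n * θ n ^ 2| * |θ n| := by
      rw [abs_mul, abs_pow]
      ring

lemma tendsto_mul_exp_sub_one_sub_mul_I {m : β → ℝ} {k : β → ℕ} {y : ℝ}
    (hm : Tendsto m l atTop) (hk : Tendsto (fun n => (k n - m n) / √(m n)) l (𝓝 y)) (u : ℝ) :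
    Tendsto (fun n => (m n : ℂ) * (Complex.exp ((u / √(m n) : ℝ) * Complex.I) - 1) -
      k n * (u / √(m n) : ℝ) * Complex.I) l (𝓝 (-(u ^ 2 / 2) - y * u * Complex.I)) := by
  set θ : β → ℝ := fun n => u / √(m n)
  have hθ : Tendsto θ l (𝓝 0) := (Real.tendsto_sqrt_atTop.comp hm).const_div_atTop u
  have hmθ : Tendsto (fun n => m n * θ n ^ 2) l (𝓝 (u ^ 2)) := by
    refine tendsto_const_nhds.congr' ?_
    filter_upwards [hm.eventually_gt_atTop 0] with n hn
    simp only [θ, div_pow, Real.sq_sqrt hn.le, mul_div_cancel₀ _ hn.ne']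
  have hquad : Tendsto (fun n => ((m n * θ n ^ 2 / 2 : ℝ) : ℂ)) l (𝓝 ((u ^ 2 / 2 : ℝ) : ℂ)) :=
    (Complex.continuous_ofReal.tendsto _).comp (hmθ.div_const 2)
  have hphase : Tendsto (fun n => (((k n - m n) / √(m n) * u : ℝ) : ℂ) * Complex.I) l
      (𝓝 ((y * u : ℝ) * Complex.I)) :=
    ((Complex.continuous_ofReal.tendsto _).comp (hk.mul_const u)).mul_const _
  have hlim := ((tendsto_ofReal_mul_exp_sub_quadratic hθ hmθ).sub hquad).sub hphase
  push_cast at hlim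
  rw [zero_sub] at hlim
  refine hlim.congr fun n => ?_
  simp only [θ]
  push_cast
  ring

lemma tendsto_scaledCharFun {a : ∀ n, ι n → ℝ} {ε : β → ℝ} {k : β → ℕ} {y : ℝ}
    (ha : ∀ᶠ n in l, ∀ i, a n i ∈ Set.Icc 0 (ε n)) (hε : Tendsto ε l (𝓝 0))
    (hm : Tendsto (fun n => ∑ i, a n i) l atTop)
    (hk : Tendsto (fun n => (k n - ∑ i, a n i) / √(∑ i, a n i)) l (𝓝 y)) (u : ℝ) :
    Tendsto (fun n => scaledCharFun (a n) (k n) u) l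
      (𝓝 (Complex.exp (-(u ^ 2 / 2) - y * u * Complex.I))) := by
  set m : β → ℝ := fun n => ∑ i, a n i
  have hpoisson : Tendsto (fun n => scaledCharFun (a n) (k n) u -
      Complex.exp (m n * (Complex.exp ((u / √(m n) : ℝ) * Complex.I) - 1) -
        k n * (u / √(m n) : ℝ) * Complex.I)) l (𝓝 0) := by
    refine squeeze_zero_norm' ?_ (by simpa using hε.mul_const (u ^ 2))
    filter_upwards [ha, hm.eventually_gt_atTop 0,
      hε.eventually_le_const (show (0 : ℝ) < 1 / 2 by norm_num)] with n ha hmn hεn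
    have hbound := norm_prod_one_add_mul_sub_exp_sum_mul_le ha hεn (u / √(m n))
    have hphase : ‖Complex.exp (-(k n * (u / √(m n) : ℝ) * Complex.I))‖ = 1 := by
      simp [Complex.norm_exp]
    rw [div_pow, Real.sq_sqrt hmn.le, mul_div_cancel₀ _ hmn.ne'] at hbound
    rwa [scaledCharFun, sub_eq_add_neg (_ * _) (_ * Complex.I), Complex.exp_add, ← sub_mul,
      norm_mul, hphase, mul_one]
  simpa using hpoisson.add
    ((Complex.continuous_exp.tendsto _).comp (tendsto_mul_exp_sub_one_sub_mul_I hm hk u))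

lemma integral_exp_neg_sq_sub_mul_I (y : ℝ) :
    ∫ u : ℝ, Complex.exp (-(u ^ 2 / 2) - y * u * Complex.I) =
      ((2 * Real.pi * gaussianPDFReal 0 1 y : ℝ) : ℂ) := by
  have hb : (-(1 / 2) : ℂ).re < 0 := by norm_num
  have hsqrt : (Real.pi / -(-(1 / 2)) : ℂ) ^ (1 / 2 : ℂ) = ((√(2 * Real.pi) : ℝ) : ℂ) := by
    rw [Real.sqrt_eq_rpow, Complex.ofReal_cpow Real.two_pi_pos.le]
    push_cast
    ring_nf
  have hpdf : 2 * Real.pi * gaussianPDFReal 0 1 y = √(2 * Real.pi) * Real.exp (-y ^ 2 / 2) := by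
    have hsq := Real.mul_self_sqrt Real.two_pi_pos.le
    have := Real.sqrt_pos.2 Real.two_pi_pos
    simp only [gaussianPDFReal, NNReal.coe_one, mul_one, sub_zero]
    field_simp
    linear_combination -hsq
  calc ∫ u : ℝ, Complex.exp (-(u ^ 2 / 2) - y * u * Complex.I)
      = ∫ u : ℝ, Complex.exp (-(1 / 2) * u ^ 2 + -(y * Complex.I) * u + 0) := by
        congr! 3 with u
        ring
    _ = (Real.pi / -(-(1 / 2)) : ℂ) ^ (1 / 2 : ℂ) *
          Complex.exp (0 - (-(y * Complex.I)) ^ 2 / (4 * -(1 / 2))) :=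
      integral_cexp_quadratic hb _ _
    _ = ((2 * Real.pi * gaussianPDFReal 0 1 y : ℝ) : ℂ) := by
      rw [hsqrt, hpdf, neg_sq, mul_pow, Complex.I_sq, Complex.ofReal_mul]
      push_cast
      ring_nf

lemma tendsto_integral_scaledCharFun [l.IsCountablyGenerated]
    {a : ∀ n, ι n → ℝ} {ε : β → ℝ} {k : β → ℕ} {y : ℝ}
    (ha : ∀ᶠ n in l, ∀ i, a n i ∈ Set.Icc 0 (ε n)) (hε : Tendsto ε l (𝓝 0))
    (hm : Tendsto (fun n => ∑ i, a n i) l atTop)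
    (hk : Tendsto (fun n => (k n - ∑ i, a n i) / √(∑ i, a n i)) l (𝓝 y)) :
    Tendsto (fun n => ∫ u in (-(Real.pi * √(∑ i, a n i)))..(Real.pi * √(∑ i, a n i)),
      scaledCharFun (a n) (k n) u) l
      (𝓝 (∫ u : ℝ, Complex.exp (-(u ^ 2 / 2) - y * u * Complex.I))) := by
  have hr_top : Tendsto (fun n => Real.pi * √(∑ i, a n i)) l atTop :=
    (Real.tendsto_sqrt_atTop.comp hm).const_mul_atTop Real.pi_pos
  have hr (n : β) : -(Real.pi * √(∑ i, a n i)) ≤ Real.pi * √(∑ i, a n i) :=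
    neg_le_self (by positivity)
  simp_rw [intervalIntegral.integral_of_le (hr _), ← integral_indicator measurableSet_Ioc]
  refine tendsto_integral_filter_of_dominated_convergence
    (fun u => Real.exp (-(1 / Real.pi ^ 2) * u ^ 2)) ?_ ?_ ?_ ?_
  · exact .of_forall fun n =>
      (continuous_scaledCharFun _ _).aestronglyMeasurable.indicator measurableSet_Ioc
  · filter_upwards [ha, hm.eventually_gt_atTop 0,
      hε.eventually_le_const (show (0 : ℝ) < 1 / 2 by norm_num)] with n ha hmn hεn
    refine .of_forall fun u => ?_
    rw [norm_indicator_eq_indicator_norm]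
    exact Set.indicator_apply_le'
      (fun hu => norm_scaledCharFun_le hmn _ (fun i => ⟨(ha i).1, (ha i).2.trans hεn⟩)
        (abs_le.2 ⟨hu.1.le, hu.2⟩))
      fun _ => (Real.exp_pos _).le
  · exact integrable_exp_neg_mul_sq (by positivity)
  · refine .of_forall fun u => (tendsto_scaledCharFun ha hε hm hk u).congr' ?_
    filter_upwards [hr_top.eventually_gt_atTop |u|] with n hn
    exact (Set.indicator_of_mem (Set.mem_Ioc.2 ⟨(abs_lt.1 hn).1, (abs_lt.1 hn).2.le⟩) _).symm

theorem tendsto_sqrt_sum_mul_coeff_poissonBinomialPoly [l.IsCountablyGenerated]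
    {a : ∀ n, ι n → ℝ} {ε : β → ℝ} {k : β → ℕ} {y : ℝ}
    (ha : ∀ᶠ n in l, ∀ i, a n i ∈ Set.Icc 0 (ε n)) (hε : Tendsto ε l (𝓝 0))
    (hm : Tendsto (fun n => ∑ i, a n i) l atTop)
    (hk : Tendsto (fun n => (k n - ∑ i, a n i) / √(∑ i, a n i)) l (𝓝 y)) :
    Tendsto (fun n => √(∑ i, a n i) * (poissonBinomialPoly (a n)).coeff (k n)) l
      (𝓝 (gaussianPDFReal 0 1 y)) := by
  have hlim := tendsto_integral_scaledCharFun ha hε hm hk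
  rw [integral_exp_neg_sq_sub_mul_I] at hlim
  have hre := ((Complex.continuous_re.tendsto _).comp hlim).div_const (2 * Real.pi)
  rw [Complex.ofReal_re, mul_div_cancel_left₀ _ Real.two_pi_pos.ne'] at hre
  refine hre.congr' ?_
  filter_upwards [hm.eventually_gt_atTop 0] with n hn
  rw [Function.comp_apply, integral_scaledCharFun hn, Complex.ofReal_re,
    mul_div_cancel_left₀ _ Real.two_pi_pos.ne']

end LocalLimit

section Tilting

open Polynomial

/-- The success probability of the exponential tilt, with weight `(1 + s) ^ k` at `k`, of the
Bernoulli law with success probability `t`. -/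
def tiltedProb {K : Type*} [Field K] (s t : K) : K := t * (1 + s) / (1 + t * s)

lemma tiltedProb_sub_one_div {K : Type*} [Field K] {q r : K} (hq : q ≠ 1) (hrq : r * q ≠ 1) :
    tiltedProb ((r - 1) / (1 - r * q)) q = r * q := by
  have hq' : 1 - q ≠ 0 := sub_ne_zero.2 hq.symm
  have hrq' : 1 - q * r ≠ 0 := sub_ne_zero.2 (mul_comm r q ▸ hrq.symm)
  have hnum : 1 + (r - 1) / (1 - r * q) = r * (1 - q) / (1 - r * q) := by
    field_simp
    ring
  have hden : 1 + q * ((r - 1) / (1 - r * q)) = (1 - q) / (1 - r * q) := by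
    field_simp
    ring
  rw [tiltedProb, hnum, hden]
  field_simp

lemma coeff_poissonBinomialPoly_mul_pow {K : Type*} [Field K] {ι : Type*} [Fintype ι] {a : ι → K}
    {s : K} (h : ∀ i, 1 + a i * s ≠ 0) (k : ℕ) :
    (poissonBinomialPoly a).coeff k * (1 + s) ^ k =
      (∏ i, (1 + a i * s)) * (poissonBinomialPoly fun i => tiltedProb s (a i)).coeff k := by
  rw [← comp_C_mul_X_coeff, ← coeff_C_mul]
  congr 1
  simp only [poissonBinomialPoly, prod_comp, map_prod, ← Finset.prod_mul_distrib]
  refine Finset.prod_congr rfl fun i _ => ?_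
  have htilt : (C (1 + a i * s) : K[X]) * C (tiltedProb s (a i)) = C (a i) * C (1 + s) := by
    rw [← C_mul, ← C_mul, tiltedProb, mul_div_cancel₀ _ (h i)]
  have hscale : (C (1 + a i * s) : K[X]) = 1 + C (a i) * (C (1 + s) - 1) := by
    simp only [C_add, C_mul, C_1, add_sub_cancel_left]
  simp only [add_comp, one_comp, mul_comp, C_comp, sub_comp, X_comp]
  linear_combination (1 - X) * htilt - hscale

variable {s t : ℝ}

lemma half_le_one_add_mul (ht : t ∈ Set.Icc 0 1) (hs : |s| ≤ 1 / 2) : 1 / 2 ≤ 1 + t * s := by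
  have := (abs_le.1 hs).1
  nlinarith [ht.1, ht.2]

lemma le_four_mul_tiltedProb (ht : t ∈ Set.Icc 0 1) (hs : |s| ≤ 1 / 2) :
    t ≤ 4 * tiltedProb s t := by
  have hden := half_le_one_add_mul ht hs
  obtain ⟨hs₀, hs₁⟩ := abs_le.1 hs
  rw [tiltedProb, ← mul_div_assoc, le_div_iff₀ (by linarith)]
  nlinarith [ht.1, ht.2, mul_nonneg ht.1 ht.1, mul_nonneg ht.1 (sub_nonneg.2 ht.2)]

lemma tiltedProb_le_four_mul (ht : t ∈ Set.Icc 0 1) (hs : |s| ≤ 1 / 2) :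
    tiltedProb s t ≤ 4 * t := by
  have hden := half_le_one_add_mul ht hs
  have := (abs_le.1 hs).2
  rw [tiltedProb, div_le_iff₀ (by linarith)]
  nlinarith [ht.1]

lemma tiltedProb_mem_Icc {c : ℝ} (hc : c ≤ 1) (ht : t ∈ Set.Icc 0 c) (hs : |s| ≤ 1 / 2) :
    tiltedProb s t ∈ Set.Icc 0 (4 * c) :=
  have ht' : t ∈ Set.Icc 0 1 := Set.Icc_subset_Icc_right hc ht
  ⟨by linarith [ht.1, le_four_mul_tiltedProb ht' hs],
    (tiltedProb_le_four_mul ht' hs).trans (by linarith [ht.2])⟩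

lemma abs_log_one_add_mul_sub_le (ht : t ∈ Set.Icc 0 1) (hs : |s| ≤ 1 / 2) :
    |Real.log (1 + t * s) - (s * t + -(s ^ 2 / 2) * t ^ 2)| ≤ 2 * |s| ^ 3 * t ^ 3 := by
  have habs : |-(t * s)| = t * |s| := by rw [abs_neg, abs_mul, abs_of_nonneg ht.1]
  have hle : t * |s| ≤ 1 / 2 := by nlinarith [ht.1, ht.2, abs_nonneg s]
  have htaylor := Real.abs_log_sub_add_sum_range_le (x := -(t * s)) (by linarith) 2
  rw [habs, le_div_iff₀ (by linarith)] at htaylor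
  norm_num [Finset.sum_range_succ] at htaylor
  rw [show Real.log (1 + t * s) - (s * t + -(s ^ 2 / 2) * t ^ 2) =
    -(t * s) + (t * s) ^ 2 / 2 + Real.log (1 + t * s) by ring]
  nlinarith [abs_nonneg (-(t * s) + (t * s) ^ 2 / 2 + Real.log (1 + t * s))]

lemma abs_tiltedProb_sub_le (ht : t ∈ Set.Icc 0 1) (hs : |s| ≤ 1 / 2) :
    |tiltedProb s t - ((1 + s) * t + -((1 + s) * s) * t ^ 2)| ≤ 4 * s ^ 2 * t ^ 3 := by
  have hden := half_le_one_add_mul ht hs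
  obtain ⟨hs₀, hs₁⟩ := abs_le.1 hs
  have hcube : 0 ≤ s ^ 2 * t ^ 3 := mul_nonneg (sq_nonneg s) (pow_nonneg ht.1 3)
  have hremainder : tiltedProb s t - ((1 + s) * t + -((1 + s) * s) * t ^ 2) =
      (1 + s) * (s ^ 2 * t ^ 3) / (1 + t * s) := by
    rw [tiltedProb]
    field_simp
    ring
  rw [hremainder, abs_of_nonneg (div_nonneg (mul_nonneg (by linarith) hcube) (by linarith)),
    div_le_iff₀ (by linarith)]
  nlinarith

end Tilting

section Comparison

variable {β : Type*} {l : Filter β} {ι κ : β → Type*} [∀ n, Fintype (ι n)] [∀ n, Fintype (κ n)]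

lemma abs_sum_comp_sub_le {ι : Type*} [Fintype ι] {a : ι → ℝ} {g : ℝ → ℝ} {A B K c : ℝ}
    (hg : ∀ t ∈ Set.Icc 0 c, |g t - (A * t + B * t ^ 2)| ≤ K * t ^ 3)
    (ha : ∀ i, a i ∈ Set.Icc 0 c) :
    |∑ i, g (a i) - (A * ∑ i, a i + B * ∑ i, a i ^ 2)| ≤ K * c * ∑ i, a i ^ 2 := by
  simp only [Finset.mul_sum, ← Finset.sum_add_distrib, ← Finset.sum_sub_distrib]
  refine (Finset.abs_sum_le_sum_abs _ _).trans (Finset.sum_le_sum fun i _ => ?_)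
  have hgi := hg _ (ha i)
  have hK : 0 ≤ K * a i ^ 2 := by
    rcases (ha i).1.eq_or_lt with h0 | hpos
    · simp [← h0]
    · exact nonneg_of_mul_nonneg_left (by linarith [abs_nonneg (g (a i) -
        (A * a i + B * a i ^ 2))] : 0 ≤ K * a i ^ 2 * a i) hpos
  calc _ ≤ K * a i ^ 2 * a i := by linarith
    _ ≤ K * a i ^ 2 * c := mul_le_mul_of_nonneg_left (ha i).2 hK
    _ = K * c * a i ^ 2 := by ring

lemma tendsto_sum_comp_sub_sum_comp {a : ∀ n, ι n → ℝ} {b : ∀ n, κ n → ℝ} {g : β → ℝ → ℝ}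
    {A B K c : β → ℝ}
    (hg : ∀ᶠ n in l, ∀ t ∈ Set.Icc 0 (c n), |g n t - (A n * t + B n * t ^ 2)| ≤ K n * t ^ 3)
    (ha : ∀ᶠ n in l, ∀ i, a n i ∈ Set.Icc 0 (c n)) (hb : ∀ᶠ n in l, ∀ i, b n i ∈ Set.Icc 0 (c n))
    (hsum : ∀ᶠ n in l, ∑ i, a n i = ∑ i, b n i)
    (hsq : Tendsto (fun n => ∑ i, a n i ^ 2 - ∑ i, b n i ^ 2) l (𝓝 0))
    (hB : Tendsto B l (𝓝 0)) (hK : Tendsto (fun n => K n * c n) l (𝓝 0))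
    (hKb : Tendsto (fun n => K n * c n * ∑ i, b n i ^ 2) l (𝓝 0)) :
    Tendsto (fun n => ∑ i, g n (a n i) - ∑ i, g n (b n i)) l (𝓝 0) := by
  have hlim := ((hB.mul hsq).abs.add (hK.mul hsq)).add (hKb.const_mul 2)
  simp only [mul_zero, abs_zero, add_zero] at hlim
  refine squeeze_zero_norm' ?_ hlim
  filter_upwards [hg, ha, hb, hsum] with n hg ha hb hsum
  have hba := abs_sum_comp_sub_le hg ha
  have hbb := abs_sum_comp_sub_le hg hb
  rw [hsum] at hba
  have hquad := abs_le.1 (le_refl |B n * (∑ i, a n i ^ 2 - ∑ i, b n i ^ 2)|)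
  rw [abs_le] at hba hbb
  rw [Real.norm_eq_abs, abs_le]
  constructor <;> linarith [hba.1, hba.2, hbb.1, hbb.2, hquad.1, hquad.2]

lemma sum_sq_le_mul_sum {ι : Type*} [Fintype ι] {a : ι → ℝ} {c : ℝ}
    (ha : ∀ i, a i ∈ Set.Icc 0 c) : ∑ i, a i ^ 2 ≤ c * ∑ i, a i := by
  rw [Finset.mul_sum]
  refine Finset.sum_le_sum fun i _ => ?_
  rw [sq]
  exact mul_le_mul_of_nonneg_right (ha i).2 (ha i).1

-- With `m` the common mean, `s ^ 2 / √m ≤ |s| ^ 3 + 1 / √m ^ 3`, and the second term is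
-- harmless because `∑ b ^ 2 ≤ c * m`.
lemma tendsto_sq_div_sqrt_sum_mul_sum_sq {b : ∀ n, κ n → ℝ} {c s : β → ℝ}
    (hb : ∀ᶠ n in l, ∀ i, b n i ∈ Set.Icc 0 (c n)) (hc : Tendsto c l (𝓝 0))
    (hm : Tendsto (fun n => ∑ i, b n i) l atTop)
    (hs : Tendsto (fun n => |s n| ^ 3 * c n * ∑ i, b n i ^ 2) l (𝓝 0)) :
    Tendsto (fun n => s n ^ 2 / √(∑ i, b n i) * c n * ∑ i, b n i ^ 2) l (𝓝 0) := by
  have hlim := hs.abs.add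
    ((hc.pow 2).mul (Real.tendsto_sqrt_atTop.comp hm).inv_tendsto_atTop)
  simp only [abs_zero, mul_zero, add_zero] at hlim
  refine squeeze_zero_norm' ?_ hlim
  filter_upwards [hb, hm.eventually_gt_atTop 0] with n hb hm
  set m := ∑ i, b n i
  set w := |c n * ∑ i, b n i ^ 2| with hw
  have hsqrt : 0 < √m := Real.sqrt_pos.2 hm
  have hinv : 0 < (√m)⁻¹ := inv_pos.2 hsqrt
  have hyoung : |s n| ^ 2 * (√m)⁻¹ ≤ |s n| ^ 3 + (√m)⁻¹ ^ 3 := by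
    nlinarith [mul_nonneg (add_nonneg (abs_nonneg (s n)) hinv.le) (sq_nonneg (|s n| - (√m)⁻¹)),
      mul_nonneg (abs_nonneg (s n)) (sq_nonneg (√m)⁻¹)]
  have hw_le : w ≤ c n ^ 2 * √m ^ 2 := by
    have hsq : 0 ≤ ∑ i, b n i ^ 2 := Finset.sum_nonneg fun i _ => sq_nonneg _
    have hle : ∑ i, b n i ^ 2 ≤ |c n| * m :=
      (sum_sq_le_mul_sum hb).trans (mul_le_mul_of_nonneg_right (le_abs_self _) hm.le)
    rw [hw, abs_mul, abs_of_nonneg hsq, Real.sq_sqrt hm.le, ← sq_abs (c n), sq, mul_assoc]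
    exact mul_le_mul_of_nonneg_left hle (abs_nonneg _)
  calc _ = |s n| ^ 2 * (√m)⁻¹ * w := by
        rw [Real.norm_eq_abs, mul_assoc, abs_mul, abs_div, abs_pow, abs_of_pos hsqrt,
          div_eq_mul_inv]
    _ ≤ (|s n| ^ 3 + (√m)⁻¹ ^ 3) * w := mul_le_mul_of_nonneg_right hyoung (abs_nonneg _)
    _ = |s n| ^ 3 * w + (√m)⁻¹ ^ 3 * w := add_mul _ _ _
    _ ≤ |s n| ^ 3 * w + (√m)⁻¹ ^ 3 * (c n ^ 2 * √m ^ 2) := by gcongr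
    _ = |s n| ^ 3 * w + c n ^ 2 * (√m)⁻¹ := by field_simp
    _ = _ := by rw [mul_assoc (|s n| ^ 3), abs_mul, abs_pow, abs_abs, hw]; rfl

lemma tendsto_div_of_tendsto_sub_div_sqrt {k m : β → ℝ} {y : ℝ} (hm : Tendsto m l atTop)
    (hk : Tendsto (fun n => (k n - m n) / √(m n)) l (𝓝 y)) :
    Tendsto (fun n => k n / m n) l (𝓝 1) := by
  have hlim := (hk.mul (Real.tendsto_sqrt_atTop.comp hm).inv_tendsto_atTop).const_add 1
  rw [mul_zero, add_zero] at hlim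
  refine hlim.congr' ?_
  filter_upwards [hm.eventually_gt_atTop 0] with n hn
  have hsq := Real.sq_sqrt hn.le
  have := Real.sqrt_pos.2 hn
  simp only [Pi.inv_apply, Function.comp_apply]
  field_simp
  rw [hsq]
  ring

lemma tendsto_div_sqrt_of_le_four_mul {d m m' : β → ℝ} (hm : ∀ᶠ n in l, 0 < m n)
    (hmm' : ∀ᶠ n in l, m n ≤ 4 * m' n) (hd : Tendsto (fun n => d n / √(m n)) l (𝓝 0)) :
    Tendsto (fun n => d n / √(m' n)) l (𝓝 0) := by
  have hlim := hd.abs.const_mul 2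
  rw [abs_zero, mul_zero] at hlim
  refine squeeze_zero_norm' ?_ hlim
  filter_upwards [hm, hmm'] with n hm hmm'
  have hsqrt := Real.sqrt_pos.2 hm
  have hsqrt' : 0 < √(m' n) := Real.sqrt_pos.2 (by linarith)
  have hle : √(m n) ≤ 2 * √(m' n) := by
    rw [Real.sqrt_le_left (by positivity), mul_pow, Real.sq_sqrt (Real.sqrt_pos.1 hsqrt').le]
    linarith
  rw [Real.norm_eq_abs, abs_div, abs_div, abs_of_pos hsqrt, abs_of_pos hsqrt', ← mul_div_assoc,
    div_le_div_iff₀ hsqrt' hsqrt, mul_right_comm, mul_comm]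
  exact mul_le_mul_of_nonneg_right hle (abs_nonneg _)

lemma tendsto_coeff_div_coeff_of_sub_div_sqrt [l.IsCountablyGenerated] {a : ∀ n, ι n → ℝ}
    {b : ∀ n, κ n → ℝ} {ε : β → ℝ} {k : β → ℕ} {y : ℝ}
    (ha : ∀ᶠ n in l, ∀ i, a n i ∈ Set.Icc 0 (ε n)) (hb : ∀ᶠ n in l, ∀ i, b n i ∈ Set.Icc 0 (ε n))
    (hε : Tendsto ε l (𝓝 0)) (hma : Tendsto (fun n => ∑ i, a n i) l atTop)
    (hmb : Tendsto (fun n => ∑ i, b n i) l atTop)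
    (hka : Tendsto (fun n => (k n - ∑ i, a n i) / √(∑ i, a n i)) l (𝓝 y))
    (hkb : Tendsto (fun n => (k n - ∑ i, b n i) / √(∑ i, b n i)) l (𝓝 y)) :
    Tendsto (fun n => (poissonBinomialPoly (a n)).coeff (k n) /
      (poissonBinomialPoly (b n)).coeff (k n)) l (𝓝 1) := by
  have hpdf : gaussianPDFReal 0 1 y ≠ 0 := (gaussianPDFReal_pos 0 1 y one_ne_zero).ne'
  have hlocal := (tendsto_sqrt_sum_mul_coeff_poissonBinomialPoly ha hε hma hka).div
    (tendsto_sqrt_sum_mul_coeff_poissonBinomialPoly hb hε hmb hkb) hpdf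
  have hratio_a := tendsto_div_of_tendsto_sub_div_sqrt hma hka
  have hratio_b := tendsto_div_of_tendsto_sub_div_sqrt hmb hkb
  have hsqrt := (Real.continuous_sqrt.tendsto _).comp (hratio_a.div hratio_b one_ne_zero)
  have hlim := hsqrt.mul hlocal
  rw [div_self hpdf, div_self one_ne_zero, Real.sqrt_one, mul_one] at hlim
  refine hlim.congr' ?_
  filter_upwards [hma.eventually_gt_atTop 0, hmb.eventually_gt_atTop 0,
    hratio_a.eventually_const_lt one_pos] with n hma hmb hk
  have hk₀ : (k n : ℝ) ≠ 0 := fun h => by simp [h] at hk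
  have hcancel : k n / (∑ i, a n i) / (k n / ∑ i, b n i) = (∑ i, b n i) / ∑ i, a n i := by
    field_simp
  have := Real.sqrt_pos.2 hma
  have := Real.sqrt_pos.2 hmb
  simp only [Pi.div_apply, Function.comp_apply]
  rw [hcancel, Real.sqrt_div hmb.le]
  field_simp

lemma tendsto_prod_one_add_mul_div_prod {a : ∀ n, ι n → ℝ} {b : ∀ n, κ n → ℝ} {c s : β → ℝ}
    (ha : ∀ᶠ n in l, ∀ i, a n i ∈ Set.Icc 0 (c n)) (hb : ∀ᶠ n in l, ∀ i, b n i ∈ Set.Icc 0 (c n))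
    (hc : Tendsto c l (𝓝 0)) (hs : Tendsto s l (𝓝 0))
    (hsum : ∀ᶠ n in l, ∑ i, a n i = ∑ i, b n i)
    (hsq : Tendsto (fun n => ∑ i, a n i ^ 2 - ∑ i, b n i ^ 2) l (𝓝 0))
    (hcube : Tendsto (fun n => |s n| ^ 3 * c n * ∑ i, b n i ^ 2) l (𝓝 0)) :
    Tendsto (fun n => (∏ i, (1 + a n i * s n)) / ∏ i, (1 + b n i * s n)) l (𝓝 1) := by
  have hc_le : ∀ᶠ n in l, c n ≤ 1 := hc.eventually_le_const one_pos
  have hs_le : ∀ᶠ n in l, |s n| ≤ 1 / 2 :=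
    hs.abs.eventually_le_const (by rw [abs_zero]; exact one_half_pos)
  have hlog := tendsto_sum_comp_sub_sum_comp (g := fun n t => Real.log (1 + t * s n))
    (A := s) (B := fun n => -(s n ^ 2 / 2)) (K := fun n => 2 * |s n| ^ 3)
    (by filter_upwards [hc_le, hs_le] with n hc hs t ht using
      abs_log_one_add_mul_sub_le ⟨ht.1, ht.2.trans hc⟩ hs) ha hb hsum hsq
    (by simpa using ((hs.pow 2).div_const 2).neg)
    (by simpa using ((hs.abs.pow 3).const_mul 2).mul hc)
    (by simpa [mul_assoc] using hcube.const_mul 2)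
  have hexp := (Real.continuous_exp.tendsto _).comp hlog
  rw [Real.exp_zero] at hexp
  refine hexp.congr' ?_
  filter_upwards [ha, hb, hc_le, hs_le] with n ha hb hc hs
  have hpos {t : ℝ} (ht : t ∈ Set.Icc 0 (c n)) : 0 < 1 + t * s n := by
    linarith [half_le_one_add_mul ⟨ht.1, ht.2.trans hc⟩ hs]
  simp only [Function.comp_apply, Real.exp_sub, Real.exp_sum, Real.exp_log (hpos (ha _)),
    Real.exp_log (hpos (hb _))]

lemma tendsto_sum_tiltedProb_sub_div_sqrt {a : ∀ n, ι n → ℝ} {b : ∀ n, κ n → ℝ} {c s : β → ℝ}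
    (ha : ∀ᶠ n in l, ∀ i, a n i ∈ Set.Icc 0 (c n)) (hb : ∀ᶠ n in l, ∀ i, b n i ∈ Set.Icc 0 (c n))
    (hc : Tendsto c l (𝓝 0)) (hs : Tendsto s l (𝓝 0))
    (hm : Tendsto (fun n => ∑ i, b n i) l atTop)
    (hsum : ∀ᶠ n in l, ∑ i, a n i = ∑ i, b n i)
    (hsq : Tendsto (fun n => ∑ i, a n i ^ 2 - ∑ i, b n i ^ 2) l (𝓝 0))
    (hcube : Tendsto (fun n => |s n| ^ 3 * c n * ∑ i, b n i ^ 2) l (𝓝 0)) :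
    Tendsto (fun n => (∑ i, tiltedProb (s n) (a n i) - ∑ i, tiltedProb (s n) (b n i)) /
      √(∑ i, b n i)) l (𝓝 0) := by
  have hinv := (Real.tendsto_sqrt_atTop.comp hm).inv_tendsto_atTop
  have hlim := tendsto_sum_comp_sub_sum_comp
    (g := fun n t => tiltedProb (s n) t / √(∑ i, b n i))
    (A := fun n => (1 + s n) / √(∑ i, b n i))
    (B := fun n => -((1 + s n) * s n) / √(∑ i, b n i))
    (K := fun n => 4 * s n ^ 2 / √(∑ i, b n i)) ?_ ha hb hsum hsq ?_ ?_ ?_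
  · simpa only [← Finset.sum_div, ← sub_div] using hlim
  · filter_upwards [hc.eventually_le_const one_pos,
      hs.abs.eventually_le_const (by rw [abs_zero]; exact one_half_pos)] with n hc hs t ht
    have hbound := abs_tiltedProb_sub_le ⟨ht.1, ht.2.trans hc⟩ hs
    rw [div_mul_eq_mul_div, div_mul_eq_mul_div, div_mul_eq_mul_div, ← add_div, ← sub_div, abs_div,
      abs_of_nonneg (Real.sqrt_nonneg _)]
    gcongr
  · simpa [div_eq_mul_inv] using ((hs.const_add 1).mul hs).neg.mul hinv
  · simpa [div_eq_mul_inv] using (((hs.pow 2).const_mul 4).mul hinv).mul hc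
  · simpa [mul_assoc, mul_div_assoc] using
      (tendsto_sq_div_sqrt_sum_mul_sum_sq hb hc hm hcube).const_mul 4

lemma sum_le_four_mul_sum_tiltedProb {ι : Type*} [Fintype ι] {a : ι → ℝ} {s : ℝ}
    (ha : ∀ i, a i ∈ Set.Icc 0 1) (hs : |s| ≤ 1 / 2) :
    ∑ i, a i ≤ 4 * ∑ i, tiltedProb s (a i) := by
  rw [Finset.mul_sum]
  exact Finset.sum_le_sum fun i _ => le_four_mul_tiltedProb (ha i) hs

lemma coeff_div_coeff_eq_mul {ι κ : Type*} [Fintype ι] [Fintype κ] {a : ι → ℝ} {b : κ → ℝ} {s : ℝ}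
    (ha : ∀ i, a i ∈ Set.Icc 0 1) (hb : ∀ i, b i ∈ Set.Icc 0 1) (hs : |s| ≤ 1 / 2) (k : ℕ) :
    (poissonBinomialPoly a).coeff k / (poissonBinomialPoly b).coeff k =
      (∏ i, (1 + a i * s)) / (∏ i, (1 + b i * s)) *
        ((poissonBinomialPoly fun i => tiltedProb s (a i)).coeff k /
          (poissonBinomialPoly fun i => tiltedProb s (b i)).coeff k) := by
  have hden {t : ℝ} (ht : t ∈ Set.Icc 0 1) : 1 + t * s ≠ 0 :=
    (one_half_pos.trans_le (half_le_one_add_mul ht hs)).ne'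
  have hpow : (1 + s) ^ k ≠ 0 := pow_ne_zero _ (by linarith [(abs_le.1 hs).1])
  rw [div_mul_div_comm, ← coeff_poissonBinomialPoly_mul_pow fun i => hden (ha i),
    ← coeff_poissonBinomialPoly_mul_pow fun i => hden (hb i), mul_div_mul_right _ _ hpow]

lemma tendsto_coeff_tiltedProb_div_coeff_tiltedProb [l.IsCountablyGenerated]
    {a : ∀ n, ι n → ℝ} {b : ∀ n, κ n → ℝ} {c s : β → ℝ} {x : β → ℕ}
    (ha : ∀ᶠ n in l, ∀ i, a n i ∈ Set.Icc 0 (c n)) (hb : ∀ᶠ n in l, ∀ i, b n i ∈ Set.Icc 0 (c n))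
    (hc : Tendsto c l (𝓝 0)) (hs : Tendsto s l (𝓝 0))
    (hm : Tendsto (fun n => ∑ i, b n i) l atTop)
    (hsum : ∀ᶠ n in l, ∑ i, a n i = ∑ i, b n i)
    (hsq : Tendsto (fun n => ∑ i, a n i ^ 2 - ∑ i, b n i ^ 2) l (𝓝 0))
    (hcube : Tendsto (fun n => |s n| ^ 3 * c n * ∑ i, b n i ^ 2) l (𝓝 0))
    (hx : ∀ᶠ n in l, ∑ i, tiltedProb (s n) (b n i) = x n) :
    Tendsto (fun n => (poissonBinomialPoly fun i => tiltedProb (s n) (a n i)).coeff (x n) /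
      (poissonBinomialPoly fun i => tiltedProb (s n) (b n i)).coeff (x n)) l (𝓝 1) := by
  have hs_le : ∀ᶠ n in l, |s n| ≤ 1 / 2 :=
    hs.abs.eventually_le_const (by rw [abs_zero]; exact one_half_pos)
  have hc_le : ∀ᶠ n in l, c n ≤ 1 := hc.eventually_le_const one_pos
  have hle_a : ∀ᶠ n in l, ∑ i, b n i ≤ 4 * ∑ i, tiltedProb (s n) (a n i) := by
    filter_upwards [hs_le, hc_le, ha, hsum] with n hs hc ha hsum
    exact hsum ▸ sum_le_four_mul_sum_tiltedProb (fun i => Set.Icc_subset_Icc_right hc (ha i)) hs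
  have hle_b : ∀ᶠ n in l, ∑ i, b n i ≤ 4 * ∑ i, tiltedProb (s n) (b n i) := by
    filter_upwards [hs_le, hc_le, hb] with n hs hc hb
    exact sum_le_four_mul_sum_tiltedProb (fun i => Set.Icc_subset_Icc_right hc (hb i)) hs
  have hmean : Tendsto (fun n => (x n - ∑ i, tiltedProb (s n) (a n i)) / √(∑ i, b n i)) l
      (𝓝 0) := by
    have hlim := (tendsto_sum_tiltedProb_sub_div_sqrt ha hb hc hs hm hsum hsq hcube).neg
    rw [neg_zero] at hlim
    refine hlim.congr' ?_
    filter_upwards [hx] with n hx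
    rw [← hx, ← neg_div, neg_sub]
  exact tendsto_coeff_div_coeff_of_sub_div_sqrt (ε := fun n => 4 * c n)
    (by filter_upwards [hs_le, hc_le, ha] with n hs hc ha i using tiltedProb_mem_Icc hc (ha i) hs)
    (by filter_upwards [hs_le, hc_le, hb] with n hs hc hb i using tiltedProb_mem_Icc hc (hb i) hs)
    (by simpa using hc.const_mul 4)
    ((tendsto_atTop_mono' l hle_a hm).atTop_of_const_mul₀ four_pos)
    ((tendsto_atTop_mono' l hle_b hm).atTop_of_const_mul₀ four_pos)
    (tendsto_div_sqrt_of_le_four_mul (hm.eventually_gt_atTop 0) hle_a hmean)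
    (tendsto_const_nhds.congr' (by filter_upwards [hx] with n hx; simp [hx]))

theorem tendsto_coeff_div_coeff_poissonBinomialPoly [l.IsCountablyGenerated]
    {a : ∀ n, ι n → ℝ} {b : ∀ n, κ n → ℝ} {c s : β → ℝ} {x : β → ℕ}
    (ha : ∀ᶠ n in l, ∀ i, a n i ∈ Set.Icc 0 (c n)) (hb : ∀ᶠ n in l, ∀ i, b n i ∈ Set.Icc 0 (c n))
    (hc : Tendsto c l (𝓝 0)) (hs : Tendsto s l (𝓝 0))
    (hm : Tendsto (fun n => ∑ i, b n i) l atTop)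
    (hsum : ∀ᶠ n in l, ∑ i, a n i = ∑ i, b n i)
    (hsq : Tendsto (fun n => ∑ i, a n i ^ 2 - ∑ i, b n i ^ 2) l (𝓝 0))
    (hcube : Tendsto (fun n => |s n| ^ 3 * c n * ∑ i, b n i ^ 2) l (𝓝 0))
    (hx : ∀ᶠ n in l, ∑ i, tiltedProb (s n) (b n i) = x n) :
    Tendsto (fun n => (poissonBinomialPoly (a n)).coeff (x n) /
      (poissonBinomialPoly (b n)).coeff (x n)) l (𝓝 1) := by
  have hlim := (tendsto_prod_one_add_mul_div_prod ha hb hc hs hsum hsq hcube).mul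
    (tendsto_coeff_tiltedProb_div_coeff_tiltedProb ha hb hc hs hm hsum hsq hcube hx)
  rw [mul_one] at hlim
  refine hlim.congr' ?_
  filter_upwards [hs.abs.eventually_le_const (by rw [abs_zero]; exact one_half_pos),
    hc.eventually_le_const one_pos, ha, hb] with n hs hc ha hb
  exact (coeff_div_coeff_eq_mul (fun i => Set.Icc_subset_Icc_right hc (ha i))
    (fun i => Set.Icc_subset_Icc_right hc (hb i)) hs _).symm

theorem tendsto_coeff_poissonBinomialPoly_div_binomialWeight [l.IsCountablyGenerated]
    {a : ∀ n, ι n → ℝ} {c q : β → ℝ} {N x : β → ℕ}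
    (ha : ∀ᶠ n in l, ∀ i, a n i ∈ Set.Icc 0 (c n)) (hq : ∀ᶠ n in l, q n ∈ Set.Icc 0 (c n))
    (hc : Tendsto c l (𝓝 0)) (hm : Tendsto (fun n => N n * q n) l atTop)
    (hsum : ∀ᶠ n in l, ∑ i, a n i = N n * q n)
    (hsq : Tendsto (fun n => ∑ i, a n i ^ 2 - N n * q n ^ 2) l (𝓝 0))
    (hx : Tendsto (fun n => x n / (N n * q n)) l (𝓝 1))
    (hcube : Tendsto (fun n => |x n / (N n * q n) - 1| ^ 3 * c n * (N n * q n ^ 2)) l (𝓝 0)) :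
    Tendsto (fun n => (poissonBinomialPoly (a n)).coeff (x n) / binomialWeight (N n) (q n) (x n)) l
      (𝓝 1) := by
  set r : β → ℝ := fun n => x n / (N n * q n) with hr
  have hq₀ : Tendsto q l (𝓝 0) := squeeze_zero' (hq.mono fun n h => h.1) (hq.mono fun n h => h.2) hc
  have hrq : Tendsto (fun n => r n * q n) l (𝓝 0) := by simpa using hx.mul hq₀
  have hden : Tendsto (fun n => 1 - r n * q n) l (𝓝 1) := by simpa using hrq.const_sub 1
  have hs : Tendsto (fun n => (r n - 1) / (1 - r n * q n)) l (𝓝 0) := by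
    simpa [Pi.div_def] using (hx.sub_const 1).div hden one_ne_zero
  simp_rw [binomialWeight_eq_coeff]
  refine tendsto_coeff_div_coeff_poissonBinomialPoly ha (hq.mono fun n h _ => h) hc hs
    (by simpa using hm) (by simpa using hsum) (by simpa using hsq) ?_ ?_
  · have hlim := hcube.div (hden.abs.pow 3) (by norm_num)
    rw [zero_div] at hlim
    refine hlim.congr fun n => ?_
    rw [Pi.div_apply, Finset.sum_const, Finset.card_univ, Fintype.card_fin, nsmul_eq_mul, abs_div,
      div_pow]
    ring
  · filter_upwards [hm.eventually_gt_atTop 0, hq₀.eventually_lt_const one_pos,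
      hrq.eventually_lt_const one_pos] with n hm hq₁ hrq₁
    have hq : q n ≠ 0 := right_ne_zero_of_mul hm.ne'
    have hN : (N n : ℝ) ≠ 0 := left_ne_zero_of_mul hm.ne'
    rw [Finset.sum_const, Finset.card_univ, Fintype.card_fin, nsmul_eq_mul,
      tiltedProb_sub_one_div hq₁.ne hrq₁.ne, hr]
    field_simp

end Comparison

section Parameters

lemma binN_pos {n : ℕ} (hn : 1 ≤ n) : 0 < binN n := by
  have hn' : (1 : ℝ) ≤ n := by exact_mod_cast hn
  rw [binN, Nat.floor_pos, one_le_div (by linarith)]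
  obtain rfl | hn₂ := hn.eq_or_lt
  · norm_num
  · have : (2 : ℝ) ≤ n := by exact_mod_cast hn₂
    nlinarith

lemma binN_mul_binP (n : ℕ) (p : ℝ) : binN n * binP n p = n * alphaN11 p := by
  rcases n.eq_zero_or_pos with rfl | hn
  · simp [binP]
  · exact mul_div_cancel₀ _ (Nat.cast_ne_zero.2 (binN_pos hn).ne')

lemma div_four_le_binN {n : ℕ} (hn : 12 ≤ n) : (n : ℝ) / 4 ≤ binN n := by
  have hn' : (12 : ℝ) ≤ n := by exact_mod_cast hn
  have hthird : (n : ℝ) / 3 ≤ n ^ 2 / (3 * n - 2) := by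
    rw [div_le_div_iff₀ three_pos (by linarith)]
    nlinarith
  have hfloor : (n : ℝ) ^ 2 / (3 * n - 2) < binN n + 1 := Nat.lt_floor_add_one _
  linarith

lemma abs_sub_sq_div_binN_le {n : ℕ} (hn : 12 ≤ n) :
    |3 * n - 2 - (n : ℝ) ^ 2 / binN n| ≤ 12 := by
  have hn' : (12 : ℝ) ≤ n := by exact_mod_cast hn
  have hquarter := div_four_le_binN hn
  have hN : (0 : ℝ) < binN n := by linarith
  have hd : (0 : ℝ) < 3 * n - 2 := by linarith
  have hfloor_le : (binN n : ℝ) ≤ n ^ 2 / (3 * n - 2) := Nat.floor_le (by positivity)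
  have hlt_floor : (n : ℝ) ^ 2 / (3 * n - 2) < binN n + 1 := Nat.lt_floor_add_one _
  rw [le_div_iff₀ hd] at hfloor_le
  rw [div_lt_iff₀ hd] at hlt_floor
  rw [abs_le, neg_le_sub_iff_le_add, div_le_iff₀ hN, sub_le_comm, le_div_iff₀ hN]
  constructor <;> nlinarith

lemma alphaN11_nonneg {p : ℝ} (hp : p ∈ Set.Icc 0 1) : 0 ≤ alphaN11 p :=
  mul_nonneg hp.1 (sub_nonneg.2 hp.2)

lemma alphaN11_mul_fibRoot_mem_Icc {p : ℝ} (hp : p ∈ Set.Icc 0 1) (n : ℕ) (i : Fin (n / 2)) :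
    alphaN11 p * fibRoot n i ∈ Set.Icc 0 (4 * alphaN11 p) := by
  have hα := alphaN11_nonneg hp
  exact ⟨mul_nonneg hα (fibRoot_pos n i).le, by nlinarith [fibRoot_le_four n i]⟩

lemma binP_mem_Icc {n : ℕ} (hn : 12 ≤ n) {p : ℝ} (hp : p ∈ Set.Icc 0 1) :
    binP n p ∈ Set.Icc 0 (4 * alphaN11 p) := by
  have hα := alphaN11_nonneg hp
  have hN : (0 : ℝ) < binN n := Nat.cast_pos.2 (binN_pos (by linarith))
  refine ⟨by unfold binP; positivity, ?_⟩
  rw [binP, div_le_iff₀ hN]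
  nlinarith [div_four_le_binN hn]

lemma sum_sq_alphaN11_mul_fibRoot_sub {n : ℕ} (hn : 1 ≤ n) (p : ℝ) :
    ∑ i, (alphaN11 p * fibRoot (n + 1) i) ^ 2 - binN n * binP n p ^ 2 =
      alphaN11 p ^ 2 * (3 * n - 2 - n ^ 2 / binN n) := by
  have hN : (binN n : ℝ) ≠ 0 := Nat.cast_ne_zero.2 (binN_pos hn).ne'
  simp only [mul_pow, ← Finset.mul_sum]
  rw [sum_fibRoot_sq hn, binP]
  field_simp

lemma abs_div_sub_one_pow_three_mul_le {n : ℕ} (hn : 12 ≤ n) {p : ℝ} (hp : p ∈ Set.Icc 0 1)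
    (hα : alphaN11 p ≠ 0) (x : ℝ) :
    |x / (n * alphaN11 p) - 1| ^ 3 * (4 * alphaN11 p) * (binN n * binP n p ^ 2) ≤
      16 * |(x - n * alphaN11 p) / (n : ℝ) ^ (2 / 3 : ℝ)| ^ 3 := by
  have hα_pos : 0 < alphaN11 p := (alphaN11_nonneg hp).lt_of_ne' hα
  have hn₀ : (0 : ℝ) < n := by positivity
  have hN : (0 : ℝ) < binN n := Nat.cast_pos.2 (binN_pos (by linarith))
  have hrpow : ((n : ℝ) ^ (2 / 3 : ℝ)) ^ 3 = n ^ 2 := by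
    rw [← Real.rpow_natCast, ← Real.rpow_mul hn₀.le]
    norm_num
  set u := |x - n * alphaN11 p|
  have hdiv : |x / (n * alphaN11 p) - 1| = u / (n * alphaN11 p) := by
    rw [div_sub_one (by positivity), abs_div, abs_of_pos (by positivity : 0 < n * alphaN11 p)]
  calc _ = 4 * u ^ 3 / (n * binN n) := by
        rw [hdiv, binP]
        field_simp
    _ ≤ 4 * u ^ 3 / (n * (n / 4)) := by
      gcongr
      exact div_four_le_binN hn
    _ = 16 * (u ^ 3 / n ^ 2) := by ring
    _ = _ := by
      rw [abs_div, div_pow, abs_of_nonneg (by positivity : 0 ≤ (n : ℝ) ^ (2 / 3 : ℝ)), hrpow]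

variable {p : ℕ → ℝ} {x : ℕ → ℕ}

lemma tendsto_alphaN11 (hp : Tendsto p atTop (𝓝 0)) :
    Tendsto (fun n => alphaN11 (p n)) atTop (𝓝 0) := by
  simpa [alphaN11] using hp.mul (hp.const_sub 1)

lemma isEquivalent_mul_alphaN11 (hp : Tendsto p atTop (𝓝 0)) :
    (fun n : ℕ => n * alphaN11 (p n)) ~[atTop] fun n => n * p n := by
  have hone : (fun n => 1 - p n) ~[atTop] fun _ => (1 : ℝ) :=
    (isEquivalent_const_iff_tendsto one_ne_zero).2 (by simpa using hp.const_sub 1)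
  simpa [alphaN11, Pi.mul_def, mul_assoc] using
    (IsEquivalent.refl (u := fun n : ℕ => n * p n)).mul hone

lemma tendsto_mul_alphaN11_atTop (hp : Tendsto p atTop (𝓝 0))
    (hnp : Tendsto (fun n : ℕ => n * p n) atTop atTop) :
    Tendsto (fun n : ℕ => n * alphaN11 (p n)) atTop atTop :=
  (isEquivalent_mul_alphaN11 hp).symm.tendsto_atTop hnp

lemma tendsto_sum_sq_alphaN11_mul_fibRoot_sub (hp : Tendsto p atTop (𝓝 0)) :
    Tendsto (fun n => ∑ i, (alphaN11 (p n) * fibRoot (n + 1) i) ^ 2 -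
      binN n * binP n (p n) ^ 2) atTop (𝓝 0) := by
  have hlim := ((tendsto_alphaN11 hp).pow 2).mul_const 12
  rw [zero_pow two_ne_zero, zero_mul] at hlim
  refine squeeze_zero_norm' ?_ hlim
  filter_upwards [eventually_ge_atTop 12] with n hn
  rw [sum_sq_alphaN11_mul_fibRoot_sub (by linarith), norm_mul, Real.norm_eq_abs, Real.norm_eq_abs,
    abs_of_nonneg (sq_nonneg _)]
  exact mul_le_mul_of_nonneg_left (abs_sub_sq_div_binN_le hn) (sq_nonneg _)

lemma tendsto_div_mul_alphaN11 (hp : Tendsto p atTop (𝓝 0))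
    (hnp : Tendsto (fun n : ℕ => n * p n) atTop atTop)
    (hx : (fun n => x n - n * alphaN11 (p n)) =o[atTop] fun n => n * p n) :
    Tendsto (fun n => x n / (n * alphaN11 (p n))) atTop (𝓝 1) := by
  have hne : ∀ᶠ n : ℕ in atTop, n * alphaN11 (p n) ≠ 0 :=
    ((tendsto_mul_alphaN11_atTop hp hnp).eventually_gt_atTop 0).mono fun _ h => h.ne'
  exact (isEquivalent_iff_tendsto_one hne).1
    (hx.trans_isEquivalent (isEquivalent_mul_alphaN11 hp).symm)

lemma tendsto_abs_div_sub_one_pow_three_mul (hp_mem : ∀ n, p n ∈ Set.Icc 0 1)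
    (hp : Tendsto p atTop (𝓝 0)) (hnp : Tendsto (fun n : ℕ => n * p n) atTop atTop)
    (hx : (fun n => x n - n * alphaN11 (p n)) =o[atTop] fun n : ℕ => (n : ℝ) ^ (2 / 3 : ℝ)) :
    Tendsto (fun n => |x n / (n * alphaN11 (p n)) - 1| ^ 3 * (4 * alphaN11 (p n)) *
      (binN n * binP n (p n) ^ 2)) atTop (𝓝 0) := by
  have hlim := (hx.tendsto_div_nhds_zero.abs.pow 3).const_mul 16
  rw [abs_zero, zero_pow three_ne_zero, mul_zero] at hlim
  refine squeeze_zero' (.of_forall fun n => ?_) ?_ hlim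
  · have := alphaN11_nonneg (hp_mem n)
    positivity
  · filter_upwards [eventually_ge_atTop 12,
      (tendsto_mul_alphaN11_atTop hp hnp).eventually_gt_atTop 0] with n hn hα
    exact abs_div_sub_one_pow_three_mul_le hn (hp_mem n) (right_ne_zero_of_mul hα.ne') _

end Parameters

theorem theorem4
    {Ω : ℕ → Type*} [∀ n, MeasurableSpace (Ω n)]
    (P : ∀ n, Measure (Ω n)) [∀ n, IsProbabilityMeasure (P n)]
    (p : ℕ → unitInterval)
    (η : ∀ n, Fin (n + 1) → Ω n → ℝ)
    (hη_bernoulli : ∀ n j, HasLaw (η n j) (bernoulliMeasure (1 : ℝ) 0 (p n)) (P n))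
    (hη_indep : ∀ n, iIndepFun (η n) (P n))
    (x : ℕ → ℕ)
    (hp : Tendsto (fun n : ℕ => (p n : ℝ)) atTop (𝓝 0))
    (hnp : Tendsto (fun n : ℕ => (n : ℝ) * p n) atTop atTop)
    (hx : (fun n : ℕ => (x n : ℝ) - (n : ℝ) * alphaN11 (p n)) =o[atTop]
      (fun n : ℕ => min ((n : ℝ) * p n) ((n : ℝ) ^ (2 / 3 : ℝ)))) :
    Tendsto
      (fun n : ℕ =>
        (P n).real {ω | countN11 (η n) ω = (x n : ℝ)} /
          binomialWeight (binN n) (binP n (p n)) (x n))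
      atTop (𝓝 1) := by
  have hmin_nonneg (n : ℕ) : 0 ≤ min ((n : ℝ) * p n) ((n : ℝ) ^ (2 / 3 : ℝ)) :=
    le_min (mul_nonneg n.cast_nonneg (p n).2.1) (by positivity)
  have hx_np : _ =o[atTop] fun n : ℕ => (n : ℝ) * p n :=
    hx.trans_le fun n => abs_le_abs_of_nonneg (hmin_nonneg n) (min_le_left _ _)
  have hx_rpow : _ =o[atTop] fun n : ℕ => (n : ℝ) ^ (2 / 3 : ℝ) :=
    hx.trans_le fun n => abs_le_abs_of_nonneg (hmin_nonneg n) (min_le_right _ _)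
  simp_rw [measureReal_countN11_eq (hη_bernoulli _) (hη_indep _), ← poissonBinomialPoly_mul_fibRoot]
  refine tendsto_coeff_poissonBinomialPoly_div_binomialWeight
    (c := fun n => 4 * alphaN11 (p n)) ?_ ?_ ?_ ?_ ?_ ?_ ?_ ?_
  · exact .of_forall fun n => alphaN11_mul_fibRoot_mem_Icc (p n).2 (n + 1)
  · filter_upwards [eventually_ge_atTop 12] with n hn using binP_mem_Icc hn (p n).2
  · simpa only [mul_zero] using (tendsto_alphaN11 hp).const_mul 4
  · simpa only [binN_mul_binP] using tendsto_mul_alphaN11_atTop hp hnp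
  · exact .of_forall fun n => by rw [← Finset.mul_sum, sum_fibRoot, binN_mul_binP, mul_comm]
  · exact tendsto_sum_sq_alphaN11_mul_fibRoot_sub hp
  · simpa only [binN_mul_binP] using tendsto_div_mul_alphaN11 hp hnp hx_np
  · simpa only [binN_mul_binP] using
      tendsto_abs_div_sub_one_pow_three_mul (fun n => (p n).2) hp hnp hx_rpow
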